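/- Let $(M,\omega)$ be a symplectic manifold (Hausdorff, second countable, without boundary, not necessarily compact or connected). For a smooth function $G$ on $M$ let $X_G$ be its Hamiltonian vector field, $\omega(X_G,\cdot)=-dG$, and let $\{F,G\}=\omega(X_G,X_F)=dF(X_G)$ be the Poisson bracket. For compact subsets $X,Y,Z\subseteq M$ define $$pb_3(X,Y,Z):=\inf\Big\{\sup_M|\{F,G\}| \;:\; F,G\in C_c^\infty(M),\ F|_X\le 0,\ G|_Y\le 0,\ (F+G)|_Z\ge 1\Big\}.$$ Let $X_1,X_2,X_3\subseteq M$ be compact subsets with $X_1\cap X_2\cap X_3=\emptyset$, and let $G\in C_c^\infty(M)$ be a Hamiltonian with $G|_{X_2}\le 0$ and $G|_{X_1\cap X_3}\ge 1$. Assume that $p_0:=\dfrac{1}{2\,pb_3(X_1,X_2,X_3)}>0$, where $p_0:=\infty$ if $pb_3(X_1,X_2,X_3)=0$. Then for every real $p>p_0$ there exists a trajectory of the Hamiltonian flow of $G$ of time-length at most $p$ going from $X_1\setminus X_3$ to $X_3\setminus X_1$ or from $X_3\setminus X_1$ to $X_1\setminus X_3$; that is, there are an integral curve $\gamma:\mathbb{R}\to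 M$ of $X_G$ and a number $0\le t\le p$ such that either $\gamma(0)\in X_1\setminus X_3$ and $\gamma(t)\in X_3\setminus X_1$, or $\gamma(0)\in X_3\setminus X_1$ and $\gamma(t)\in X_1\setminus X_3$. -/

import Mathlib

open Set Manifold
open scoped ContDiff ENNReal

section SymplecticManifold

variable {E : Type*} [NormedAddCommGroup E] [NormedSpace ℝ E]
  {M : Type*} [TopologicalSpace M] [ChartedSpace E M]

/-- The expression of a 2-form `σ` on `M` in the chart `e`, that is, the pullback of `σ` by the
inverse chart; it is a 2-form on the open subset `e.target` of `E`. -/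
noncomputable def twoFormInChart
    (σ : (x : M) → TangentSpace 𝓘(ℝ, E) x [⋀^Fin 2]→L[ℝ] ℝ)
    (e : OpenPartialHomeomorph M E) (y : E) : E [⋀^Fin 2]→L[ℝ] ℝ :=
  (σ (e.symm y)).compContinuousLinearMap (mfderiv 𝓘(ℝ, E) 𝓘(ℝ, E) e.symm y)

/-- The differential of a function `G : M → ℝ` at `x`, as a linear form on the tangent space. -/
noncomputable def differentialAt (G : M → ℝ) (x : M) : TangentSpace 𝓘(ℝ, E) x →ₗ[ℝ] ℝ :=
  (NormedSpace.fromTangentSpace (𝕜 := ℝ) (G x)).toLinearMap ∘ₗ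
    (mfderiv 𝓘(ℝ, E) 𝓘(ℝ, ℝ) G x).toLinearMap

variable (E M) in
/-- A symplectic form on a manifold `M` without boundary, modelled on `E`: a smooth, closed,
nondegenerate differential 2-form. Smoothness and closedness are expressed in the charts of the
atlas. -/
structure SymplecticForm where
  toFun : (x : M) → TangentSpace 𝓘(ℝ, E) x [⋀^Fin 2]→L[ℝ] ℝ
  smooth : ∀ e ∈ atlas E M, ContDiffOn ℝ ∞ (twoFormInChart toFun e) e.target
  closed : ∀ e ∈ atlas E M, ∀ y ∈ e.target, extDeriv (twoFormInChart toFun e) y = 0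
  nondegenerate : ∀ (x : M) (v : TangentSpace 𝓘(ℝ, E) x),
    (∀ w : TangentSpace 𝓘(ℝ, E) x, toFun x ![v, w] = 0) → v = 0

namespace SymplecticForm

theorem update_pair_zero {V : Type*} (v w a : V) : Function.update ![v, w] 0 a = ![a, w] := by
  ext i; fin_cases i <;> rfl

theorem update_pair_one {V : Type*} (v w a : V) : Function.update ![v, w] 1 a = ![v, a] := by
  ext i; fin_cases i <;> rfl

/-- `v ↦ σ(v, ·)` as a linear map from the tangent space to its dual. -/
noncomputable def flat (σ : SymplecticForm E M) (x : M) :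
    TangentSpace 𝓘(ℝ, E) x →ₗ[ℝ] (TangentSpace 𝓘(ℝ, E) x →ₗ[ℝ] ℝ) :=
  LinearMap.mk₂ ℝ (fun v w => σ.toFun x ![v, w])
    (fun v v' w => by
      have h := (σ.toFun x).map_update_add ![v, w] 0 v v'
      simpa only [update_pair_zero, update_pair_one, smul_eq_mul] using h)
    (fun c v w => by
      have h := (σ.toFun x).map_update_smul ![v, w] 0 c v
      simpa only [update_pair_zero, update_pair_one, smul_eq_mul] using h)
    (fun v w w' => by
      have h := (σ.toFun x).map_update_add ![v, w] 1 w w'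
      simpa only [update_pair_zero, update_pair_one, smul_eq_mul] using h)
    (fun c v w => by
      have h := (σ.toFun x).map_update_smul ![v, w] 1 c w
      simpa only [update_pair_zero, update_pair_one, smul_eq_mul] using h)

theorem flat_apply (σ : SymplecticForm E M) (x : M) (v w : TangentSpace 𝓘(ℝ, E) x) :
    σ.flat x v w = σ.toFun x ![v, w] := rfl

theorem flat_bijective [FiniteDimensional ℝ E] (σ : SymplecticForm E M) (x : M) :
    Function.Bijective (σ.flat x) := by
  have : FiniteDimensional ℝ (TangentSpace 𝓘(ℝ, E) x) := inferInstanceAs (FiniteDimensional ℝ E)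
  have hinj : Function.Injective (σ.flat x) := by
    rw [injective_iff_map_eq_zero]
    intro v hv
    refine σ.nondegenerate x v fun w => ?_
    rw [← flat_apply, hv, LinearMap.zero_apply]
  refine ⟨hinj, ?_⟩
  exact (LinearMap.injective_iff_surjective_of_finrank_eq_finrank
    (Subspace.dual_finrank_eq (K := ℝ) (V := TangentSpace 𝓘(ℝ, E) x)).symm).1 hinj

/-- The Hamiltonian vector field `X_G` of `G`, determined by `σ(X_G, ·) = -dG`. -/
noncomputable def hamiltonianVectorField [FiniteDimensional ℝ E] (σ : SymplecticForm E M)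
    (G : M → ℝ) (x : M) : TangentSpace 𝓘(ℝ, E) x :=
  (LinearEquiv.ofBijective (σ.flat x) (σ.flat_bijective x)).symm (-differentialAt G x)

theorem hamiltonianVectorField_spec [FiniteDimensional ℝ E] (σ : SymplecticForm E M)
    (G : M → ℝ) (x : M) (w : TangentSpace 𝓘(ℝ, E) x) :
    σ.toFun x ![σ.hamiltonianVectorField G x, w] = -differentialAt G x w := by
  rw [← flat_apply]
  have h := (LinearEquiv.ofBijective (σ.flat x) (σ.flat_bijective x)).apply_symm_apply
    (-differentialAt G x)
  exact congrArg (fun L : TangentSpace 𝓘(ℝ, E) x →ₗ[ℝ] ℝ => L w) h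

/-- The Poisson bracket `{F, G} = σ(X_G, X_F) = dF(X_G)`. -/
noncomputable def poissonBracket [FiniteDimensional ℝ E] (σ : SymplecticForm E M)
    (F G : M → ℝ) (x : M) : ℝ :=
  σ.toFun x ![σ.hamiltonianVectorField G x, σ.hamiltonianVectorField F x]

/-- `C_c^∞(M)`: the smooth compactly supported real functions on `M`. -/
def testFunctions (E M : Type*) [NormedAddCommGroup E] [NormedSpace ℝ E]
    [TopologicalSpace M] [ChartedSpace E M] : Set (M → ℝ) :=
  {F | ContMDiff 𝓘(ℝ, E) 𝓘(ℝ, ℝ) ∞ F ∧ HasCompactSupport F}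

/-- The Poisson bracket invariant `pb₃(X, Y, Z)` of three subsets: the infimum of the supremum norm
of `{F, G}` over the `F, G ∈ C_c^∞(M)` with `F ≤ 0` on `X`, `G ≤ 0` on `Y` and `F + G ≥ 1` on `Z`.
It is an element of `[0, ∞]`. -/
noncomputable def pb₃ [FiniteDimensional ℝ E] (σ : SymplecticForm E M) (X Y Z : Set M) : ℝ≥0∞ :=
  sInf {c | ∃ F ∈ testFunctions E M, ∃ G ∈ testFunctions E M,
    (∀ x ∈ X, F x ≤ 0) ∧ (∀ x ∈ Y, G x ≤ 0) ∧ (∀ x ∈ Z, 1 ≤ F x + G x) ∧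
    c = ⨆ x : M, ENNReal.ofReal |σ.poissonBracket F G x|}

/-- The Hamiltonian flow of `G` has a trajectory of time-length at most `p` going from `A` to `B`:
an integral curve `γ` of the Hamiltonian vector field of `G`, defined for all times, with
`γ 0 ∈ A` and `γ t ∈ B` for some `0 ≤ t ≤ p`. -/
def HasTrajectory [FiniteDimensional ℝ E] (σ : SymplecticForm E M) (G : M → ℝ) (A B : Set M)
    (p : ℝ) : Prop :=
  ∃ γ : ℝ → M, IsMIntegralCurve (I := 𝓘(ℝ, E)) γ (σ.hamiltonianVectorField G) ∧
    ∃ t : ℝ, 0 ≤ t ∧ t ≤ p ∧ γ 0 ∈ A ∧ γ t ∈ B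

end SymplecticForm

end SymplecticManifold

/-! The proof is by contraposition: if no trajectory of length at most `p` joins `X₁ \ X₃` and `X₃ \
X₁`, then `pb₃` is at most `1 / (2 * p)`, which contradicts `p₀ < p`. The competitors are `F = w(G)
H` and `P = 1 - w(G)`. Here `w` is a decreasing profile from `1` at `0` to `0` near `1`, and `H` is
at most `0` on the part of `X₁`, and at least `1` on the part of `X₃`, where `w(G)` may be nonzero.
Then `F ≤ 0` on `X₁`, `P = 0` on `X₂`, and `F + P = 1 + w(G) (H - 1) ≥ 1` on `X₃`. Since `{G, G} =
0`, the bracket collapses to `{F, P} = -w'(G) w(G) {H, G}`.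

The two factors are estimated separately. As `w w' = (w²/2)'`, the product `|w w'|` cannot stay
below `1/2`; the ideal profile `√(1 - t)` attains this value, and `exists_profile` comes arbitrarily
close to it. For `{H, G} = dH(X_G)`, `exists_separating_function` takes a function `f` with values
in `[0, 1]` that is `0` on the flow-out of one set and `1` on that of the other for times in `[-p/2,
p/2]`, and averages it over this time window along the flow. The average changes at rate at most
`1/p` along trajectories.

The flow is only shown to be locally Lipschitz in space, so the average is only locally Lipschitz.
`exists_smoothing` replaces it by a smooth function with almost the same values and almost the same
bound along the flow. These losses are harmless because `p > p₀` is strict. -/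

/-! ### Vector fields read in charts -/

section ChartField

open Topology

variable {E : Type*} [NormedAddCommGroup E] [NormedSpace ℝ E]
  {M : Type*} [TopologicalSpace M] [ChartedSpace E M]

/-- The expression of a vector field in the preferred chart at `x₀`. -/
noncomputable def chartField (v : (x : M) → TangentSpace 𝓘(ℝ, E) x) (x₀ : M) (u : E) : E :=
  mfderiv 𝓘(ℝ, E) 𝓘(ℝ, E) (chartAt E x₀) ((chartAt E x₀).symm u) (v ((chartAt E x₀).symm u))

theorem mfderiv_chartAt_symm_chartField [IsManifold 𝓘(ℝ, E) 1 M]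
    (v : (x : M) → TangentSpace 𝓘(ℝ, E) x) (x₀ : M) {u : E} (hu : u ∈ (chartAt E x₀).target) :
    mfderiv 𝓘(ℝ, E) 𝓘(ℝ, E) (chartAt E x₀).symm u (chartField (E := E) v x₀ u) =
      v ((chartAt E x₀).symm u) := by
  have h := (mdifferentiable_chart (I := 𝓘(ℝ, E)) x₀).symm_comp_deriv
    ((chartAt E x₀).map_target hu)
  rw [(chartAt E x₀).right_inv hu] at h
  exact congrArg (fun L : TangentSpace 𝓘(ℝ, E) ((chartAt E x₀).symm u) →L[ℝ]
    TangentSpace 𝓘(ℝ, E) ((chartAt E x₀).symm u) => L (v ((chartAt E x₀).symm u))) h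

/-- The tangent bundle trivialization at `x₀` is the derivative of the chart at `x₀`, so the section
read there is `chartField v x₀` composed with the chart. This supplies the hypothesis of the
existence and uniqueness theorems for integral curves. -/
theorem contMDiff_of_contDiffOn_chartField [IsManifold 𝓘(ℝ, E) ∞ M]
    {v : (x : M) → TangentSpace 𝓘(ℝ, E) x}
    (hv : ∀ x₀, ContDiffOn ℝ 1 (chartField v x₀) (chartAt E x₀).target) :
    ContMDiff 𝓘(ℝ, E) 𝓘(ℝ, E).tangent 1 (fun x => (⟨x, v x⟩ : TangentBundle 𝓘(ℝ, E) M)) := by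
  have : IsManifold 𝓘(ℝ, E) (1 + 1) M := IsManifold.of_le (n := ∞) (by norm_cast)
  have : IsManifold 𝓘(ℝ, E) 1 M := IsManifold.of_le (n := ∞) (by norm_cast)
  intro x₀
  rw [Bundle.contMDiffAt_section]
  have h1 : ContMDiffAt 𝓘(ℝ, E) 𝓘(ℝ, E) 1 (chartField v x₀ ∘ chartAt E x₀) x₀ := by
    have h2 : ContDiffAt ℝ 1 (chartField v x₀) (chartAt E x₀ x₀) :=
      (hv x₀).contDiffAt ((chartAt E x₀).open_target.mem_nhds (mem_chart_target E x₀))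
    exact ContMDiffAt.comp x₀ h2.contMDiffAt
      (contMDiffAt_of_mem_maximalAtlas (IsManifold.chart_mem_maximalAtlas x₀)
        (mem_chart_source E x₀))
  refine h1.congr_of_eventuallyEq ?_
  filter_upwards [(chartAt E x₀).open_source.mem_nhds (mem_chart_source E x₀)] with x hx
  have h3 := TangentBundle.continuousLinearMapAt_trivializationAt (I := 𝓘(ℝ, E)) hx
  have h4 : (trivializationAt E (TangentSpace 𝓘(ℝ, E)) x₀ ⟨x, v x⟩).2 =
      (trivializationAt E (TangentSpace 𝓘(ℝ, E)) x₀).continuousLinearMapAt ℝ x (v x) := by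
    rw [Bundle.Trivialization.continuousLinearMapAt_apply,
      Bundle.Trivialization.coe_linearMapAt_of_mem _ (by simpa using hx)]
  rw [h4, h3]
  simp only [Function.comp_apply, chartField]
  rw [(chartAt E x₀).left_inv hx]
  congr 2

end ChartField

/-! ### Support and regularity of Hamiltonian vector fields -/

namespace SymplecticForm

variable {E : Type*} [NormedAddCommGroup E] [NormedSpace ℝ E]
  {M : Type*} [TopologicalSpace M] [ChartedSpace E M]

theorem differentialAt_apply (G : M → ℝ) (x : M) (w : TangentSpace 𝓘(ℝ, E) x) :
    differentialAt G x w = mfderiv 𝓘(ℝ, E) 𝓘(ℝ, ℝ) G x w := rfl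

theorem toFun_swap (σ : SymplecticForm E M) (x : M) (a b : TangentSpace 𝓘(ℝ, E) x) :
    σ.toFun x ![a, b] = -σ.toFun x ![b, a] := by
  have h := (σ.toFun x).map_swap ![b, a] (i := 0) (j := 1) (by decide)
  refine Eq.trans ?_ h
  change σ.toFun x _ = σ.toFun x _
  congr 1
  ext i; fin_cases i <;> rfl

variable [FiniteDimensional ℝ E]

/-- `{F, G} = dF(X_G)`. -/
theorem poissonBracket_eq (σ : SymplecticForm E M) (F G : M → ℝ) (x : M) :
    σ.poissonBracket F G x = differentialAt F x (σ.hamiltonianVectorField G x) := by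
  rw [poissonBracket, toFun_swap, hamiltonianVectorField_spec, neg_neg]

theorem poissonBracket_swap (σ : SymplecticForm E M) (F G : M → ℝ) (x : M) :
    σ.poissonBracket F G x = -σ.poissonBracket G F x := by
  rw [poissonBracket, toFun_swap, poissonBracket]

theorem hamiltonianVectorField_eq_zero (σ : SymplecticForm E M) {G : M → ℝ} {x : M}
    (hx : x ∉ tsupport G) : σ.hamiltonianVectorField G x = 0 := by
  have h : G =ᶠ[nhds x] fun _ => 0 := by
    filter_upwards [(isClosed_tsupport G).isOpen_compl.mem_nhds hx] with y hy
    exact image_eq_zero_of_notMem_tsupport hy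
  have hd : differentialAt (E := E) G x = 0 := by
    ext w
    rw [differentialAt_apply, h.mfderiv_eq]
    have := mfderiv_const (I := 𝓘(ℝ, E)) (I' := 𝓘(ℝ, ℝ)) (c := (0 : ℝ)) (x := x)
    rw [this]
    rfl
  rw [hamiltonianVectorField, hd, neg_zero, map_zero]

theorem twoFormInChart_chartField [IsManifold 𝓘(ℝ, E) ∞ M] (σ : SymplecticForm E M) {G : M → ℝ}
    (hG : ContMDiff 𝓘(ℝ, E) 𝓘(ℝ, ℝ) ∞ G) (x₀ : M) {u : E} (hu : u ∈ (chartAt E x₀).target)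
    (b : E) :
    twoFormInChart σ.toFun (chartAt E x₀) u
        ![chartField (σ.hamiltonianVectorField G) x₀ u, b] =
      -fderiv ℝ (G ∘ (chartAt E x₀).symm) u b := by
  have : IsManifold 𝓘(ℝ, E) 1 M := IsManifold.of_le (n := ∞) (by norm_cast)
  set e := chartAt E x₀
  have h1 : twoFormInChart σ.toFun e u ![chartField (σ.hamiltonianVectorField G) x₀ u, b] =
      σ.toFun (e.symm u) ![σ.hamiltonianVectorField G (e.symm u),
        (mfderiv 𝓘(ℝ, E) 𝓘(ℝ, E) e.symm u : E → _) b] := by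
    change σ.toFun (e.symm u) (fun i => (mfderiv 𝓘(ℝ, E) 𝓘(ℝ, E) e.symm u : E → _)
      ((![chartField (σ.hamiltonianVectorField G) x₀ u, b] : Fin 2 → E) i)) = _
    congr 1
    rw [← mfderiv_chartAt_symm_chartField (σ.hamiltonianVectorField G) x₀ hu]
    ext i; fin_cases i <;> rfl
  rw [h1, hamiltonianVectorField_spec, differentialAt_apply, ← mfderiv_eq_fderiv]
  have h2 : MDifferentiableAt 𝓘(ℝ, E) 𝓘(ℝ, E) e.symm u :=
    (mdifferentiable_chart (I := 𝓘(ℝ, E)) x₀).mdifferentiableAt_symm hu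
  have h3 : MDifferentiableAt 𝓘(ℝ, E) 𝓘(ℝ, ℝ) G (e.symm u) :=
    (hG (e.symm u)).mdifferentiableAt (by simp)
  rw [mfderiv_comp u h3 h2]
  rfl

/-- In a chart, `X_G` solves a linear equation whose operator `E → E*` is the curried 2-form,
invertible by nondegeneracy and smooth in the base point. Operator inversion is smooth at invertible
operators, so the solution is smooth too. -/
theorem contDiffOn_chartField [IsManifold 𝓘(ℝ, E) ∞ M] (σ : SymplecticForm E M) {G : M → ℝ}
    (hG : ContMDiff 𝓘(ℝ, E) 𝓘(ℝ, ℝ) ∞ G) (x₀ : M) :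
    ContDiffOn ℝ 1 (chartField (σ.hamiltonianVectorField G) x₀) (chartAt E x₀).target := by
  have : IsManifold 𝓘(ℝ, E) 1 M := IsManifold.of_le (n := ∞) (by norm_cast)
  set e := chartAt E x₀ with he
  have hσ := σ.smooth e (chart_mem_atlas E x₀)
  have hpair (a b : E) : ContDiffOn ℝ ∞ (fun u => twoFormInChart σ.toFun e u ![a, b]) e.target :=
    (ContinuousAlternatingMap.apply ℝ E ℝ ![a, b]).contDiff.comp_contDiffOn hσ
  let L (T : E [⋀^Fin 2]→L[ℝ] ℝ) : E →L[ℝ] E →L[ℝ] ℝ :=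
    (ContinuousLinearMap.compL ℝ E (E [⋀^Fin 0]→L[ℝ] ℝ) ℝ
      (ContinuousAlternatingMap.apply ℝ E ℝ ![])).comp
      ((ContinuousAlternatingMap.curryLeftLI).toContinuousLinearMap.comp T.curryLeft)
  have hL (T : E [⋀^Fin 2]→L[ℝ] ℝ) (a b : E) : L T a b = T ![a, b] := rfl
  have hLs : ContDiffOn ℝ ∞ (fun u => L (twoFormInChart σ.toFun e u)) e.target :=
    contDiffOn_clm_apply.2 fun a => contDiffOn_clm_apply.2 fun b => hpair a b
  have hg : ContDiffOn ℝ ∞ (G ∘ e.symm) e.target := by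
    rw [← contMDiffOn_iff_contDiffOn]
    exact hG.comp_contMDiffOn (contMDiffOn_chart_symm (I := 𝓘(ℝ, E)))
  have hdg : ContDiffOn ℝ ∞ (fderiv ℝ (G ∘ e.symm)) e.target :=
    hg.fderiv_of_isOpen e.open_target (by simp)
  have hinj (u : E) (hu : u ∈ e.target) :
      Function.Injective (L (twoFormInChart σ.toFun e u)) := by
    rw [injective_iff_map_eq_zero]
    intro a ha
    have hD := (mdifferentiable_chart (I := 𝓘(ℝ, E)) x₀).symm.mfderiv_bijective (x := u) hu
    have h0 : mfderiv 𝓘(ℝ, E) 𝓘(ℝ, E) e.symm u a = 0 := by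
      apply σ.nondegenerate
      intro w
      obtain ⟨b, rfl⟩ := hD.2 w
      have h1 : L (twoFormInChart σ.toFun e u) a b = 0 := by rw [ha]; rfl
      refine Eq.trans ?_ ((hL _ a b).symm.trans h1)
      change _ = σ.toFun (e.symm u) (fun i => (mfderiv 𝓘(ℝ, E) 𝓘(ℝ, E) e.symm u : E → _)
        ((![a, b] : Fin 2 → E) i))
      congr 1
      ext i; fin_cases i <;> rfl
    exact hD.1 (h0.trans (map_zero (mfderiv 𝓘(ℝ, E) 𝓘(ℝ, E) e.symm u)).symm)
  have hequiv (u : E) (hu : u ∈ e.target) :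
      ∃ A : E ≃L[ℝ] (E →L[ℝ] ℝ), (A : E →L[ℝ] E →L[ℝ] ℝ) = L (twoFormInChart σ.toFun e u) := by
    have hfin : Module.finrank ℝ E = Module.finrank ℝ (E →L[ℝ] ℝ) := by
      rw [← (LinearMap.toContinuousLinearMap (𝕜 := ℝ) (E := E) (F' := ℝ)).finrank_eq]
      exact (Subspace.dual_finrank_eq (K := ℝ) (V := E)).symm
    refine ⟨(LinearEquiv.ofInjectiveOfFinrankEq
      (L (twoFormInChart σ.toFun e u)).toLinearMap (hinj u hu) hfin).toContinuousLinearEquiv, ?_⟩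
    ext a b
    rfl
  have key : ∀ u ∈ e.target, chartField (σ.hamiltonianVectorField G) x₀ u =
      (L (twoFormInChart σ.toFun e u)).inverse (-fderiv ℝ (G ∘ e.symm) u) := by
    intro u hu
    obtain ⟨A, hA⟩ := hequiv u hu
    rw [← hA, ContinuousLinearMap.inverse_equiv, ContinuousLinearEquiv.coe_coe,
      ContinuousLinearEquiv.eq_symm_apply]
    ext b
    have h := σ.twoFormInChart_chartField hG x₀ hu b
    rw [← hL, ← hA] at h
    exact h
  refine ContDiffOn.congr (fun u hu => ContDiffAt.contDiffWithinAt ?_) key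
  obtain ⟨A, hA⟩ := hequiv u hu
  have hnhds := e.open_target.mem_nhds hu
  have hinv : ContDiffAt ℝ ∞ (fun u => (L (twoFormInChart σ.toFun e u)).inverse) u := by
    have h1 := contDiffAt_map_inverse (n := ∞) A
    rw [hA] at h1
    exact ContDiffAt.comp u h1 (hLs.contDiffAt hnhds)
  exact (hinv.clm_apply (hdg.contDiffAt hnhds).neg).of_le (by norm_cast)

end SymplecticForm

/-! ### Local and global flows -/

section Flow

open Topology Metric

/-- Picard–Lindelöf yields solutions that are Lipschitz in the initial value, uniformly in time.
Joint continuity at `(y₀, 0)` then allows shrinking space and time so that solutions stay in `N`. -/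
theorem ContDiffAt.exists_local_flow_lipschitz {E : Type*} [NormedAddCommGroup E] [NormedSpace ℝ E]
    [CompleteSpace E] {w : E → E} {y₀ : E} (hw : ContDiffAt ℝ 1 w y₀) {N : Set E} (hN : N ∈ 𝓝 y₀) :
    ∃ U ∈ 𝓝 y₀, ∃ ε > 0, ∃ K : ℝ, ∃ α : E → ℝ → E,
      (∀ y ∈ U, α y 0 = y) ∧
      (∀ y ∈ U, ∀ t ∈ Ioo (-ε) ε, HasDerivAt (α y) (w (α y t)) t ∧ α y t ∈ N) ∧
      (∀ y ∈ U, ∀ z ∈ U, ∀ t ∈ Ioo (-ε) ε, ‖α y t - α z t‖ ≤ K * ‖y - z‖) := by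
  obtain ⟨ε, hε, a, r, L, K, hr, hpl⟩ := IsPicardLindelof.of_contDiffAt_one hw
  obtain ⟨α, hα1, L', hα2⟩ :=
    (hpl 0).exists_forall_mem_closedBall_eq_hasDerivWithinAt_lipschitzOnWith
  simp only [zero_sub, zero_add] at hα1 hα2
  have hcont : ContinuousOn (Function.uncurry α) (closedBall y₀ r ×ˢ Icc (-ε) ε) :=
    continuousOn_prod_of_continuousOn_lipschitzOnWith _ L'
      (fun x hx => HasDerivWithinAt.continuousOn (hα1 x hx).2) hα2
  have hr' : (0 : ℝ) < r := hr
  have hat : ContinuousAt (Function.uncurry α) (y₀, 0) :=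
    hcont.continuousAt (prod_mem_nhds (closedBall_mem_nhds _ hr')
      (Icc_mem_nhds (by linarith) hε))
  have h0 : Function.uncurry α (y₀, 0) = y₀ := (hα1 y₀ (mem_closedBall_self hr'.le)).1
  have hpre : Function.uncurry α ⁻¹' N ∈ 𝓝 (y₀, (0 : ℝ)) := hat (by rwa [h0])
  rw [nhds_prod_eq, Filter.mem_prod_iff] at hpre
  obtain ⟨U, hU, T, hT, hUT⟩ := hpre
  obtain ⟨δ, hδ, hδT⟩ := Metric.mem_nhds_iff.1 hT
  rw [Real.ball_eq_Ioo, zero_sub, zero_add] at hδT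
  refine ⟨U ∩ closedBall y₀ r, Filter.inter_mem hU (closedBall_mem_nhds _ hr'), min ε δ,
    lt_min hε hδ, L', α, fun y hy => (hα1 y hy.2).1, fun y hy t ht => ⟨?_, ?_⟩,
    fun y hy z hz t ht => ?_⟩
  · have h1 : -ε < t := by linarith [ht.1, min_le_left ε δ]
    have h2 : t < ε := ht.2.trans_le (min_le_left _ _)
    exact ((hα1 y hy.2).2 t ⟨h1.le, h2.le⟩).hasDerivAt (Icc_mem_nhds h1 h2)
  · have h1 : -δ < t := by linarith [ht.1, min_le_right ε δ]
    have h2 : t < δ := ht.2.trans_le (min_le_right _ _)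
    exact hUT (mk_mem_prod hy.1 (hδT ⟨h1, h2⟩))
  · have h1 : -ε < t := by linarith [ht.1, min_le_left ε δ]
    have h2 : t < ε := ht.2.trans_le (min_le_left _ _)
    have := (hα2 t ⟨h1.le, h2.le⟩).dist_le_mul y hy.2 z hz.2
    simpa only [dist_eq_norm] using this

variable {E : Type*} [NormedAddCommGroup E] [NormedSpace ℝ E]
  {M : Type*} [TopologicalSpace M] [ChartedSpace E M] [IsManifold 𝓘(ℝ, E) ∞ M]
  {v : (x : M) → TangentSpace 𝓘(ℝ, E) x}

theorem isMIntegralCurveOn_chartAt_symm_comp (x₀ : M) {α : ℝ → E} {s : Set ℝ}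
    (hα : ∀ t ∈ s, HasDerivAt α (chartField v x₀ (α t)) t)
    (hmem : ∀ t ∈ s, α t ∈ (chartAt E x₀).target) :
    IsMIntegralCurveOn ((chartAt E x₀).symm ∘ α) v s := by
  have : IsManifold 𝓘(ℝ, E) 1 M := IsManifold.of_le (n := ∞) (by norm_cast)
  intro t ht
  have h1 : HasMFDerivAt 𝓘(ℝ, ℝ) 𝓘(ℝ, E) α t
      ((1 : ℝ →L[ℝ] ℝ).smulRight (chartField (E := E) v x₀ (α t))) :=
    (hα t ht).hasFDerivAt.hasMFDerivAt
  have h2 := ((mdifferentiable_chart (I := 𝓘(ℝ, E)) x₀).mdifferentiableAt_symm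
    (hmem t ht)).hasMFDerivAt
  have h3 := (h2.comp t h1).hasMFDerivWithinAt (s := s)
  have h4 := mfderiv_chartAt_symm_chartField v x₀ (hmem t ht)
  suffices h5 : ((1 : ℝ →L[ℝ] ℝ).smulRight (v ((chartAt E x₀).symm (α t)))) =
      (mfderiv 𝓘(ℝ, E) 𝓘(ℝ, E) (chartAt E x₀).symm (α t)).comp
        ((1 : ℝ →L[ℝ] ℝ).smulRight (chartField (E := E) v x₀ (α t))) from
    Eq.mpr (congrArg (fun L : TangentSpace 𝓘(ℝ, ℝ) t →L[ℝ]
      TangentSpace 𝓘(ℝ, E) ((chartAt E x₀).symm (α t)) =>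
      HasMFDerivWithinAt 𝓘(ℝ, ℝ) 𝓘(ℝ, E) ((chartAt E x₀).symm ∘ α) s t L) h5) h3
  refine ContinuousLinearMap.ext fun (c : ℝ) => ?_
  change c • v ((chartAt E x₀).symm (α t)) =
    mfderiv 𝓘(ℝ, E) 𝓘(ℝ, E) (chartAt E x₀).symm (α t) (c • chartField (E := E) v x₀ (α t))
  rw [← h4]
  exact (map_smul (mfderiv 𝓘(ℝ, E) 𝓘(ℝ, E) (chartAt E x₀).symm (α t)) c _).symm

theorem HasMFDerivAt.hasDerivAt_chartAt_comp {γ : ℝ → M} {t : ℝ}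
    (hγ : HasMFDerivAt 𝓘(ℝ, ℝ) 𝓘(ℝ, E) γ t ((1 : ℝ →L[ℝ] ℝ).smulRight (v (γ t))))
    (x₀ : M) (hmem : γ t ∈ (chartAt E x₀).source) :
    HasDerivAt (chartAt E x₀ ∘ γ) (chartField v x₀ (chartAt E x₀ (γ t))) t := by
  have : IsManifold 𝓘(ℝ, E) 1 M := IsManifold.of_le (n := ∞) (by norm_cast)
  have h2 := ((mdifferentiable_chart (I := 𝓘(ℝ, E)) x₀).mdifferentiableAt hmem).hasMFDerivAt
  have h3 := (h2.comp t hγ).hasFDerivAt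
  rw [hasDerivAt_iff_hasFDerivAt]
  suffices h5 : ContinuousLinearMap.toSpanSingleton ℝ
      (chartField v x₀ (chartAt E x₀ (γ t)) : E) =
      (mfderiv 𝓘(ℝ, E) 𝓘(ℝ, E) (chartAt E x₀) (γ t)).comp
        ((1 : ℝ →L[ℝ] ℝ).smulRight (v (γ t))) from
    Eq.mpr (congrArg (fun L : ℝ →L[ℝ] E => HasFDerivAt (chartAt E x₀ ∘ γ) L t) h5) h3
  refine ContinuousLinearMap.ext fun (c : ℝ) => ?_
  change c • chartField v x₀ (chartAt E x₀ (γ t)) =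
    mfderiv 𝓘(ℝ, E) 𝓘(ℝ, E) (chartAt E x₀) (γ t) (c • v (γ t))
  rw [chartField, (chartAt E x₀).left_inv hmem]
  exact (map_smul (mfderiv 𝓘(ℝ, E) 𝓘(ℝ, E) (chartAt E x₀) (γ t)) c (v (γ t))).symm

variable [FiniteDimensional ℝ E]

theorem exists_local_flow_lipschitz
    (hv : ∀ x₀, ContDiffOn ℝ 1 (chartField v x₀) (chartAt E x₀).target)
    (x₀ : M) {N : Set M} (hN : N ∈ 𝓝 x₀) :
    ∃ W ∈ 𝓝 x₀, ∃ ε > 0, ∃ K : ℝ, ∃ β : M → ℝ → M,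
      (∀ y ∈ W, β y 0 = y ∧ IsMIntegralCurveOn (β y) v (Ioo (-ε) ε)) ∧
      (∀ y ∈ W, ∀ t ∈ Ioo (-ε) ε, β y t ∈ N) ∧
      (∀ y ∈ W, ∀ z ∈ W, ∀ t ∈ Ioo (-ε) ε,
        ‖chartAt E x₀ (β y t) - chartAt E x₀ (β z t)‖ ≤
          K * ‖chartAt E x₀ y - chartAt E x₀ z‖) := by
  set e := chartAt E x₀ with he
  have htgt : e.target ∈ 𝓝 (e x₀) := e.open_target.mem_nhds (mem_chart_target E x₀)
  have hsymm : e.symm ⁻¹' N ∈ 𝓝 (e x₀) := by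
    have := e.continuousAt_symm (mem_chart_target E x₀)
    refine this ?_
    rwa [e.left_inv (mem_chart_source E x₀)]
  obtain ⟨U, hU, ε, hε, K, α, h0, h1, h2⟩ :=
    ((hv x₀).contDiffAt htgt).exists_local_flow_lipschitz (Filter.inter_mem htgt hsymm)
  refine ⟨e.source ∩ e ⁻¹' U, Filter.inter_mem (e.open_source.mem_nhds (mem_chart_source E x₀))
    ((e.continuousAt (mem_chart_source E x₀)) hU), ε, hε, K, fun y => e.symm ∘ α (e y),
    fun y hy => ⟨?_, ?_⟩, fun y hy t ht => (h1 _ hy.2 t ht).2.2, fun y hy z hz t ht => ?_⟩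
  · change e.symm (α (e y) 0) = y
    rw [h0 _ hy.2, e.left_inv hy.1]
  · exact isMIntegralCurveOn_chartAt_symm_comp x₀ (fun t ht => (h1 _ hy.2 t ht).1)
      fun t ht => (h1 _ hy.2 t ht).2.1
  · simp only [Function.comp_apply]
    rw [e.right_inv (h1 _ hy.2 t ht).2.1, e.right_inv (h1 _ hz.2 t ht).2.1]
    exact h2 _ hy.2 _ hz.2 t ht

variable [T2Space M]

/-- A compactly supported vector field is complete. -/
theorem exists_global_flow
    (hv : ∀ x₀, ContDiffOn ℝ 1 (chartField v x₀) (chartAt E x₀).target)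
    {C : Set M} (hC : IsCompact C) (hvC : ∀ x ∉ C, v x = 0) :
    ∃ φ : M → ℝ → M, ∀ x, φ x 0 = x ∧ IsMIntegralCurve (φ x) v := by
  have : IsManifold 𝓘(ℝ, E) 1 M := IsManifold.of_le (n := ∞) (by norm_cast)
  -- Compactness gives a common existence time on `C`. Off `C` the constant curves serve, so the
  -- same time works everywhere and integral curves extend to all of `ℝ`.
  have hunif : ∃ ε > 0, ∀ x ∈ C, ∃ γ : ℝ → M, γ 0 = x ∧ IsMIntegralCurveOn γ v (Ioo (-ε) ε) := by
    refine hC.induction_on (p := fun s => ∃ ε > 0, ∀ x ∈ s, ∃ γ : ℝ → M, γ 0 = x ∧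
      IsMIntegralCurveOn γ v (Ioo (-ε) ε)) ⟨1, one_pos, by simp⟩ ?_ ?_ ?_
    · rintro s t hst ⟨ε, hε, h⟩
      exact ⟨ε, hε, fun x hx => h x (hst hx)⟩
    · rintro s t ⟨ε, hε, h⟩ ⟨δ, hδ, h'⟩
      refine ⟨min ε δ, lt_min hε hδ, ?_⟩
      rintro x (hx | hx)
      · obtain ⟨γ, h0, h1⟩ := h x hx
        exact ⟨γ, h0, h1.mono (Ioo_subset_Ioo (neg_le_neg (min_le_left _ _)) (min_le_left _ _))⟩
      · obtain ⟨γ, h0, h1⟩ := h' x hx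
        exact ⟨γ, h0, h1.mono (Ioo_subset_Ioo (neg_le_neg (min_le_right _ _)) (min_le_right _ _))⟩
    · intro x _
      obtain ⟨W, hW, ε, hε, K, β, h, -⟩ := exists_local_flow_lipschitz hv x Filter.univ_mem
      exact ⟨W, mem_nhdsWithin_of_mem_nhds hW, ε, hε, fun y hy => ⟨β y, h y hy⟩⟩
  obtain ⟨ε, hε, h⟩ := hunif
  have h' (x : M) : ∃ γ : ℝ → M, γ 0 = x ∧ IsMIntegralCurve γ v := by
    refine exists_isMIntegralCurve_of_isMIntegralCurveOn (contMDiff_of_contDiffOn_chartField hv)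
      hε (fun x => ?_) x
    by_cases hx : x ∈ C
    · exact h x hx
    · exact ⟨fun _ => x, rfl, (isMIntegralCurve_const (hvC x hx)).isMIntegralCurveOn _⟩
  choose φ hφ using h'
  exact ⟨φ, hφ⟩

variable {φ : M → ℝ → M}

omit [FiniteDimensional ℝ E] in
theorem flow_add (hv : ∀ x₀, ContDiffOn ℝ 1 (chartField v x₀) (chartAt E x₀).target)
    (hφ : ∀ x, φ x 0 = x ∧ IsMIntegralCurve (φ x) v) (x : M) (s t : ℝ) :
    φ (φ x s) t = φ x (t + s) := by
  have : IsManifold 𝓘(ℝ, E) 1 M := IsManifold.of_le (n := ∞) (by norm_cast)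
  have h := isMIntegralCurve_Ioo_eq_of_contMDiff_boundaryless (t₀ := 0)
    (contMDiff_of_contDiffOn_chartField hv) (hφ (φ x s)).2 ((hφ x).2.comp_add s)
    (by simp [(hφ _).1])
  exact congrFun h t

theorem flow_local_lipschitz
    (hv : ∀ x₀, ContDiffOn ℝ 1 (chartField v x₀) (chartAt E x₀).target)
    (hφ : ∀ x, φ x 0 = x ∧ IsMIntegralCurve (φ x) v)
    (x₀ : M) {N : Set M} (hN : N ∈ 𝓝 x₀) :
    ∃ W ∈ 𝓝 x₀, ∃ ε > 0, ∃ K : ℝ,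
      (∀ y ∈ W, ∀ t ∈ Ioo (-ε) ε, φ y t ∈ N) ∧
      (∀ y ∈ W, ∀ z ∈ W, ∀ t ∈ Ioo (-ε) ε,
        ‖chartAt E x₀ (φ y t) - chartAt E x₀ (φ z t)‖ ≤
          K * ‖chartAt E x₀ y - chartAt E x₀ z‖) := by
  have : IsManifold 𝓘(ℝ, E) 1 M := IsManifold.of_le (n := ∞) (by norm_cast)
  obtain ⟨W, hW, ε, hε, K, β, h0, h1, h2⟩ := exists_local_flow_lipschitz hv x₀ hN
  have heq (y) (hy : y ∈ W) : EqOn (φ y) (β y) (Ioo (-ε) ε) :=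
    isMIntegralCurveOn_Ioo_eqOn_of_contMDiff_boundaryless (t₀ := 0) ⟨by linarith, hε⟩
      (contMDiff_of_contDiffOn_chartField hv) ((hφ y).2.isMIntegralCurveOn _) (h0 y hy).2
      ((hφ y).1.trans (h0 y hy).1.symm)
  refine ⟨W, hW, ε, hε, K, fun y hy t ht => ?_, fun y hy z hz t ht => ?_⟩
  · rw [heq y hy ht]; exact h1 y hy t ht
  · rw [heq y hy ht, heq z hz ht]; exact h2 y hy z hz t ht

end Flow

/-! ### Lipschitz dependence of the flow on the initial point -/

section LipschitzFlow

open Topology Metric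

variable {E : Type*} [NormedAddCommGroup E] [NormedSpace ℝ E]
  {M : Type*} [TopologicalSpace M] [ChartedSpace E M]
  {F : Type*} [NormedAddCommGroup F] [NormedSpace ℝ F]

variable (E) in
/-- `f` is Lipschitz near `x`, when expressed in the preferred chart at `c`. -/
def LipschitzNear (f : M → F) (c x : M) : Prop :=
  ∃ U ∈ 𝓝 x, ∃ K : ℝ, 0 ≤ K ∧ ∀ y ∈ U, ∀ z ∈ U,
    ‖f y - f z‖ ≤ K * ‖chartAt E c y - chartAt E c z‖

theorem ContMDiffAt.lipschitzNear [IsManifold 𝓘(ℝ, E) ∞ M] {f : M → F} {c x : M}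
    (hf : ContMDiffAt 𝓘(ℝ, E) 𝓘(ℝ, F) 1 f x) (hx : x ∈ (chartAt E c).source) :
    LipschitzNear E f c x := by
  have : IsManifold 𝓘(ℝ, E) 1 M := IsManifold.of_le (n := ∞) (by norm_cast)
  set e := chartAt E c
  have h1 : ContDiffAt ℝ 1 (f ∘ e.symm) (e x) := by
    rw [← contMDiffAt_iff_contDiffAt]
    refine ContMDiffAt.comp (e x) ?_ ((contMDiffOn_chart_symm (I := 𝓘(ℝ, E))).contMDiffAt
      (e.open_target.mem_nhds (e.map_source hx)))
    rwa [e.left_inv hx]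
  obtain ⟨K, s, hs, hK⟩ := h1.exists_lipschitzOnWith
  refine ⟨e.source ∩ e ⁻¹' s, Filter.inter_mem (e.open_source.mem_nhds hx) (e.continuousAt hx hs),
    K, K.2, fun y hy z hz => ?_⟩
  have h := hK.dist_le_mul (e y) hy.2 (e z) hz.2
  rwa [dist_eq_norm, dist_eq_norm, Function.comp_apply, Function.comp_apply, e.left_inv hy.1,
    e.left_inv hz.1] at h

theorem contMDiffAt_chartAt [IsManifold 𝓘(ℝ, E) ∞ M] {c x : M}
    (hx : x ∈ (chartAt E c).source) : ContMDiffAt 𝓘(ℝ, E) 𝓘(ℝ, E) 1 (chartAt E c) x := by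
  have : IsManifold 𝓘(ℝ, E) 1 M := IsManifold.of_le (n := ∞) (by norm_cast)
  exact contMDiffAt_of_mem_maximalAtlas (IsManifold.chart_mem_maximalAtlas c) hx

variable (E) in
/-- Continuity and local Lipschitz continuity of a self-map of `M` at a point. -/
def MapLipschitzAt (h : M → M) (x : M) : Prop :=
  ContinuousAt h x ∧ ∀ g : M → E, ContMDiffAt 𝓘(ℝ, E) 𝓘(ℝ, E) 1 g (h x) →
    LipschitzNear E (g ∘ h) x x

/-- Quantifying over `C¹` test maps `g` makes the notion composable: the chart at `h x` is itself an
admissible test map for `h`, and it converts the bound for `k` into one at `x`. -/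
theorem MapLipschitzAt.comp [IsManifold 𝓘(ℝ, E) ∞ M] {h k : M → M} {x : M}
    (hk : MapLipschitzAt E k (h x)) (hh : MapLipschitzAt E h x) :
    MapLipschitzAt E (k ∘ h) x := by
  refine ⟨ContinuousAt.comp hk.1 hh.1, fun g hg => ?_⟩
  obtain ⟨U, hU, K, hK, h1⟩ := hk.2 g hg
  obtain ⟨V, hV, L, hL, h2⟩ := hh.2 _ (contMDiffAt_chartAt (mem_chart_source E (h x)))
  refine ⟨V ∩ h ⁻¹' U, Filter.inter_mem hV (hh.1 hU), K * L, mul_nonneg hK hL,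
    fun y hy z hz => ?_⟩
  calc _ ≤ K * ‖chartAt E (h x) (h y) - chartAt E (h x) (h z)‖ := h1 _ hy.2 _ hz.2
    _ ≤ K * (L * ‖chartAt E x y - chartAt E x z‖) := by gcongr; exact h2 _ hy.1 _ hz.1
    _ = _ := by ring

variable [IsManifold 𝓘(ℝ, E) ∞ M] {v : (x : M) → TangentSpace 𝓘(ℝ, E) x}
  [FiniteDimensional ℝ E] [T2Space M] {φ : M → ℝ → M}

theorem mapLipschitzAt_flow_of_small
    (hv : ∀ x₀, ContDiffOn ℝ 1 (chartField v x₀) (chartAt E x₀).target)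
    (hφ : ∀ x, φ x 0 = x ∧ IsMIntegralCurve (φ x) v) (c : M) :
    ∃ W ∈ 𝓝 c, ∃ ε > 0, ∀ x ∈ W, ∀ t ∈ Ioo (-ε) ε, MapLipschitzAt E (φ · t) x := by
  set e := chartAt E c
  obtain ⟨W, hW, ε, hε, K, h1, h2⟩ := flow_local_lipschitz hv hφ c
    (e.open_source.mem_nhds (mem_chart_source E c))
  refine ⟨interior W, interior_mem_nhds.2 hW, ε, hε, fun x hx t ht => ?_⟩
  have hWx : W ∈ 𝓝 x := mem_interior_iff_mem_nhds.1 hx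
  have hxW : x ∈ W := mem_of_mem_nhds hWx
  have hxe : x ∈ e.source := by
    have := h1 x hxW 0 ⟨by linarith, hε⟩
    rwa [(hφ x).1] at this
  have hcont : ContinuousAt (φ · t) x := by
    have hlim : Filter.Tendsto (fun y => e (φ y t)) (𝓝 x) (𝓝 (e (φ x t))) := by
      rw [tendsto_iff_norm_sub_tendsto_zero]
      have h3 : Filter.Tendsto (fun y => K * ‖e y - e x‖) (𝓝 x) (𝓝 0) := by
        have h4 := tendsto_iff_norm_sub_tendsto_zero.1 (e.continuousAt hxe)
        simpa using h4.const_mul K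
      refine squeeze_zero' (Filter.Eventually.of_forall fun _ => norm_nonneg _) ?_ h3
      filter_upwards [hWx] with y hy using h2 y hy x hxW t ht
    have h5 := (e.continuousAt_symm (e.map_source (h1 x hxW t ht))).tendsto.comp hlim
    rw [e.left_inv (h1 x hxW t ht)] at h5
    refine h5.congr' ?_
    filter_upwards [hWx] with y hy using e.left_inv (h1 y hy t ht)
  refine ⟨hcont, fun g hg => ?_⟩
  obtain ⟨U, hU, L, hL, h6⟩ := hg.lipschitzNear (h1 x hxW t ht)
  obtain ⟨V, hV, L', hL', h7⟩ :=
    (contMDiffAt_chartAt (E := E) hxe).lipschitzNear (mem_chart_source E x)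
  refine ⟨W ∩ V ∩ (φ · t) ⁻¹' U, Filter.inter_mem (Filter.inter_mem hWx hV) (hcont hU),
    L * (max K 0 * L'), by positivity, fun y hy z hz => ?_⟩
  calc _ ≤ L * ‖e (φ y t) - e (φ z t)‖ := h6 _ hy.2 _ hz.2
    _ ≤ L * (K * ‖e y - e z‖) := by gcongr; exact h2 _ hy.1.1 _ hz.1.1 t ht
    _ ≤ L * (max K 0 * (L' * ‖chartAt E x y - chartAt E x z‖)) := by
        gcongr
        · exact le_max_left _ _
        · exact h7 _ hy.1.2 _ hz.1.2
    _ = _ := by ring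

/-- Short-time regularity near `φ x t₁` and the group law carry the property between any two times
close to `t₁`. The set of good times is therefore clopen in `ℝ`, and it contains `0`. -/
theorem mapLipschitzAt_flow
    (hv : ∀ x₀, ContDiffOn ℝ 1 (chartField v x₀) (chartAt E x₀).target)
    (hφ : ∀ x, φ x 0 = x ∧ IsMIntegralCurve (φ x) v) (x : M) (t : ℝ) :
    MapLipschitzAt E (φ · t) x := by
  set S : Set ℝ := {t | MapLipschitzAt E (φ · t) x}
  have hprop : ∀ t₁, ∃ V ∈ 𝓝 t₁, ∀ t₂ ∈ V, ∀ t₃ ∈ V, t₂ ∈ S → t₃ ∈ S := by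
    intro t₁
    obtain ⟨W, hW, ε, hε, h⟩ := mapLipschitzAt_flow_of_small hv hφ (φ x t₁)
    refine ⟨ball t₁ (ε / 2) ∩ φ x ⁻¹' W, Filter.inter_mem (ball_mem_nhds _ (half_pos hε))
      ((hφ x).2.continuous.continuousAt hW), fun t₂ h₂ t₃ h₃ hS => ?_⟩
    have hst : t₃ - t₂ ∈ Ioo (-ε) ε := by
      have h4 := h₂.1
      have h5 := h₃.1
      rw [mem_ball, Real.dist_eq, abs_lt] at h4 h5
      constructor <;> linarith
    have h6 := (h _ h₂.2 _ hst).comp hS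
    have h7 : (fun y => φ y (t₃ - t₂)) ∘ (fun y => φ y t₂) = fun y => φ y t₃ := by
      funext y
      simp only [Function.comp_apply]
      rw [flow_add hv hφ, sub_add_cancel]
    rwa [h7] at h6
  have hclopen : IsClopen S := by
    constructor
    · rw [← isOpen_compl_iff, isOpen_iff_mem_nhds]
      intro t₁ h₁
      obtain ⟨V, hV, h⟩ := hprop t₁
      filter_upwards [hV] with t₂ h₂ hS using h₁ (h t₂ h₂ t₁ (mem_of_mem_nhds hV) hS)
    · rw [isOpen_iff_mem_nhds]
      intro t₁ h₁
      obtain ⟨V, hV, h⟩ := hprop t₁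
      filter_upwards [hV] with t₂ h₂ using h t₁ (mem_of_mem_nhds hV) t₂ h₂ h₁
  have h0 : (0 : ℝ) ∈ S := by
    obtain ⟨W, hW, ε, hε, h⟩ := mapLipschitzAt_flow_of_small hv hφ x
    exact h x (mem_of_mem_nhds hW) 0 ⟨by linarith, hε⟩
  have : S = univ := hclopen.eq_univ ⟨0, h0⟩
  exact eq_univ_iff_forall.1 this t

theorem continuous_flow
    (hv : ∀ x₀, ContDiffOn ℝ 1 (chartField v x₀) (chartAt E x₀).target)
    (hφ : ∀ x, φ x 0 = x ∧ IsMIntegralCurve (φ x) v) :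
    Continuous (Function.uncurry φ) := by
  rw [continuous_iff_continuousAt]
  rintro ⟨x, t⟩ N hN
  obtain ⟨W, hW, ε, hε, -, h1, -⟩ := flow_local_lipschitz hv hφ (φ x t) hN
  have h2 := (mapLipschitzAt_flow hv hφ x t).1 hW
  change ∀ᶠ q in 𝓝 (x, t), Function.uncurry φ q ∈ N
  filter_upwards [prod_mem_nhds h2 (ball_mem_nhds t hε)]
  rintro ⟨y, s⟩ ⟨hy, hs⟩
  have hs' : s - t ∈ Ioo (-ε) ε := by
    rw [mem_ball, Real.dist_eq, abs_lt] at hs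
    exact hs
  have h3 := h1 _ hy _ hs'
  rwa [flow_add hv hφ, sub_add_cancel] at h3

/-- A `C¹` function composed with the flow is locally Lipschitz in space, uniformly on compact
time intervals. -/
theorem exists_lipschitz_comp_flow
    (hv : ∀ x₀, ContDiffOn ℝ 1 (chartField v x₀) (chartAt E x₀).target)
    (hφ : ∀ x, φ x 0 = x ∧ IsMIntegralCurve (φ x) v) {f : M → F}
    (hf : ContMDiff 𝓘(ℝ, E) 𝓘(ℝ, F) 1 f) (x : M) {T : Set ℝ} (hT : IsCompact T) :
    ∃ U ∈ 𝓝 x, ∃ K : ℝ, 0 ≤ K ∧ ∀ t ∈ T, ∀ y ∈ U, ∀ z ∈ U,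
      ‖f (φ y t) - f (φ z t)‖ ≤ K * ‖chartAt E x y - chartAt E x z‖ := by
  -- Near a fixed time `t` the map is the time-`t` flow followed by a short-time flow, both
  -- Lipschitz; compactness of `T` merges the local constants.
  refine hT.induction_on (p := fun T => ∃ U ∈ 𝓝 x, ∃ K : ℝ, 0 ≤ K ∧ ∀ t ∈ T, ∀ y ∈ U, ∀ z ∈ U,
      ‖f (φ y t) - f (φ z t)‖ ≤ K * ‖chartAt E x y - chartAt E x z‖)
      ⟨univ, Filter.univ_mem, 0, le_rfl, by simp⟩ ?_ ?_ ?_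
  · rintro s t hst ⟨U, hU, K, hK, h⟩
    exact ⟨U, hU, K, hK, fun r hr => h r (hst hr)⟩
  · rintro s t ⟨U, hU, K, hK, h⟩ ⟨V, hV, L, hL, h'⟩
    refine ⟨U ∩ V, Filter.inter_mem hU hV, max K L, hK.trans (le_max_left _ _), ?_⟩
    rintro r (hr | hr) y hy z hz
    · exact (h r hr y hy.1 z hz.1).trans (by gcongr; exact le_max_left _ _)
    · exact (h' r hr y hy.2 z hz.2).trans (by gcongr; exact le_max_right _ _)
  · intro t _
    obtain ⟨N, hN, L, hL, h1⟩ := (hf (φ x t)).lipschitzNear (mem_chart_source E (φ x t))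
    obtain ⟨W, hW, ε, hε, K, h2, h3⟩ := flow_local_lipschitz hv hφ (φ x t) hN
    have h4 := mapLipschitzAt_flow hv hφ x t
    obtain ⟨V, hV, K', hK', h5⟩ := h4.2 _ (contMDiffAt_chartAt (mem_chart_source E (φ x t)))
    refine ⟨ball t ε, mem_nhdsWithin_of_mem_nhds (ball_mem_nhds t hε), V ∩ (φ · t) ⁻¹' W,
      Filter.inter_mem hV (h4.1 hW), L * (max K 0 * K'), by positivity, fun s hs y hy z hz => ?_⟩
    have hs' : s - t ∈ Ioo (-ε) ε := by
      rw [mem_ball, Real.dist_eq, abs_lt] at hs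
      exact hs
    have h6 (y) : φ y s = φ (φ y t) (s - t) := by rw [flow_add hv hφ, sub_add_cancel]
    rw [h6 y, h6 z]
    calc _ ≤ L * _ := h1 _ (h2 _ hy.2 _ hs') _ (h2 _ hz.2 _ hs')
      _ ≤ L * (K * _) := mul_le_mul_of_nonneg_left (h3 _ hy.2 _ hz.2 _ hs') hL
      _ ≤ L * (max K 0 * (K' * ‖chartAt E x y - chartAt E x z‖)) := by
        gcongr
        · exact le_max_left _ _
        · exact h5 _ hy.1 _ hz.1
      _ = _ := by ring

end LipschitzFlow

/-! ### Mollification in a vector space -/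

section Mollification

open Topology Metric MeasureTheory

variable {E : Type*} [NormedAddCommGroup E] [NormedSpace ℝ E] [FiniteDimensional ℝ E]

/-- Mollification of a Lipschitz function, with control of increments. -/
theorem LipschitzWith.exists_contDiff_approx {L : NNReal} {h : E → ℝ} (hh : LipschitzWith L h)
    {ε : ℝ} (hε : 0 < ε) :
    ∃ g : E → ℝ, ContDiff ℝ ∞ g ∧ (∀ y, |g y - h y| ≤ L * ε) ∧
      ∀ y d : E, ∀ C : ℝ, (∀ u ∈ ball y ε, |h (u + d) - h u| ≤ C) → |g (y + d) - g y| ≤ C := by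
  let _ : MeasurableSpace E := borel E
  have : BorelSpace E := ⟨rfl⟩
  let μ : Measure E := Measure.addHaar
  let b : ContDiffBump (0 : E) := ⟨ε / 2, ε, by positivity, by linarith⟩
  have hcont := hh.continuous
  refine ⟨convolution (b.normed μ) h (ContinuousLinearMap.lsmul ℝ ℝ) μ, ?_, fun y => ?_,
    fun y d C hC => ?_⟩
  · exact b.hasCompactSupport_normed.contDiff_convolution_left (n := ⊤) _ b.contDiff_normed
      hcont.locallyIntegrable
  · rw [← Real.dist_eq]
    refine b.dist_normed_convolution_le hcont.aestronglyMeasurable fun x hx => ?_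
    exact (hh.dist_le_mul x y).trans (by gcongr; exact (mem_ball.1 hx).le)
  -- An increment of the convolution is a weighted average of increments of `h` based in the ball of
  -- radius `ε`.
  · have hint (y : E) : Integrable (fun z => b.normed μ z * h (y - z)) μ :=
      (b.continuous_normed.mul (by fun_prop)).integrable_of_hasCompactSupport
        b.hasCompactSupport_normed.mul_right
    have heq (y : E) : convolution (b.normed μ) h (ContinuousLinearMap.lsmul ℝ ℝ) μ y =
        ∫ z, b.normed μ z * h (y - z) ∂μ := rfl
    rw [heq, heq, ← integral_sub (hint _) (hint _), ← Real.norm_eq_abs]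
    calc _ ≤ ∫ z, b.normed μ z * C ∂μ := by
          refine norm_integral_le_of_norm_le (b.integrable_normed.mul_const C)
            (Filter.Eventually.of_forall fun z => ?_)
          rw [← mul_sub, norm_mul, Real.norm_of_nonneg (b.nonneg_normed z)]
          by_cases hz : z ∈ ball (0 : E) ε
          · refine mul_le_mul_of_nonneg_left ?_ (b.nonneg_normed z)
            have h1 := hC (y - z) (by simpa [mem_ball, dist_eq_norm] using hz)
            rwa [Real.norm_eq_abs, add_sub_right_comm]
          · have h2 : b.normed μ z = 0 := by
              rw [← Function.notMem_support, b.support_normed_eq]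
              exact hz
            simp [h2]
      _ = C := by rw [integral_mul_const, b.integral_normed, one_mul]

/-- A Lipschitz function whose increments along the flow lines of `w` are bounded by `c` has smooth
approximations whose derivative along `w` is almost bounded by `c`. -/
theorem LipschitzWith.exists_contDiff_approx_of_flow {L : NNReal} {h : E → ℝ}
    (hh : LipschitzWith L h) {w : E → E} {y₀ : E} {r R τ c : ℝ} (hr : 0 < r) (hτ : 0 < τ)
    (hrR : 2 * r ≤ R) (hc : 0 ≤ c) (hw : ContinuousOn w (closedBall y₀ R)) {Φ : E → ℝ → E}
    (hΦ0 : ∀ u ∈ ball y₀ (2 * r), Φ u 0 = u)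
    (hΦ : ∀ u ∈ ball y₀ (2 * r), ∀ t ∈ Ioo (-τ) τ, Φ u t ∈ ball y₀ R ∧
      HasDerivAt (Φ u) (w (Φ u t)) t ∧ |h (Φ u t) - h u| ≤ c * |t|)
    {η : ℝ} (hη : 0 < η) :
    ∃ g : E → ℝ, ContDiff ℝ ∞ g ∧ (∀ y, |g y - h y| ≤ η) ∧
      ∀ y ∈ ball y₀ r, |fderiv ℝ g y (w y)| ≤ c + η := by
  obtain ⟨B, hB⟩ := (isCompact_closedBall y₀ R).exists_bound_of_continuousOn hw
  have hB0 : 0 ≤ B := (norm_nonneg _).trans (hB y₀ (mem_closedBall_self (by linarith)))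
  have hL : (0 : ℝ) ≤ L := L.2
  set η' := η / (L + 1) with hη'
  have hη'0 : 0 < η' := by positivity
  have hLη : L * η' ≤ η := by
    rw [hη', mul_div_assoc', div_le_iff₀ (by positivity)]
    nlinarith
  obtain ⟨δ, hδ, hδw⟩ := Metric.uniformContinuousOn_iff.1
    ((isCompact_closedBall y₀ R).uniformContinuousOn_of_continuous hw) η' hη'0
  -- The three bounds keep `u` in the ball of radius `2 * r`, use up half of the continuity modulus
  -- `δ` (flow drift uses the other half), and keep the error `L * ε` below `η`.
  set ε := min r (min (δ / 2) η')
  have hε : 0 < ε := by positivity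
  have hεr : ε ≤ r := min_le_left _ _
  have hεδ : ε ≤ δ / 2 := (min_le_right _ _).trans (min_le_left _ _)
  have hεη : ε ≤ η' := (min_le_right _ _).trans (min_le_right _ _)
  obtain ⟨g, hg, hgh, hgC⟩ := hh.exists_contDiff_approx hε
  refine ⟨g, hg, fun y => (hgh y).trans ?_, fun y hy => ?_⟩
  · exact (mul_le_mul_of_nonneg_left hεη hL).trans hLη
  have hyR : y ∈ closedBall y₀ R := ball_subset_closedBall (ball_subset_ball (by linarith) hy)
  have hline : HasDerivAt (fun s : ℝ => g (y + s • w y)) (fderiv ℝ g y (w y)) 0 := by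
    have h1 : HasDerivAt (fun s : ℝ => y + s • w y) (w y) 0 := by
      simpa using ((hasDerivAt_id (0 : ℝ)).smul_const (w y)).const_add y
    have h2 : HasFDerivAt g (fderiv ℝ g y) (y + (0 : ℝ) • w y) := by
      rw [zero_smul, add_zero]
      exact (hg.differentiable (by simp) y).hasFDerivAt
    exact h2.comp_hasDerivAt (0 : ℝ) h1
  rw [← Real.norm_eq_abs]
  -- Increments of `g` along the line `y + s • w y` suffice, and these reduce to increments of `h`
  -- along parallel segments starting at nearby points `u`. Each segment deviates from the flow line
  -- through `u` by at most `η' * |s|`.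
  refine hline.le_of_lip' (by linarith) ?_
  have hs0 : 0 < min τ (δ / 2 / (B + 1)) := by positivity
  filter_upwards [ball_mem_nhds (0 : ℝ) hs0] with s hs
  rw [mem_ball, dist_zero_right, Real.norm_eq_abs, lt_min_iff] at hs
  obtain ⟨hsτ, hsδ⟩ := hs
  rw [lt_div_iff₀ (by positivity)] at hsδ
  simp only [zero_smul, add_zero, sub_zero, Real.norm_eq_abs]
  refine hgC y (s • w y) _ fun u hu => ?_
  have hu2 : u ∈ ball y₀ (2 * r) := by
    rw [mem_ball] at hu hy ⊢
    linarith [dist_triangle u y y₀]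
  have hseg : ∀ q ∈ uIcc 0 s, q ∈ Ioo (-τ) τ ∧ |q| ≤ |s| := by
    intro q hq
    have h1 : |q| ≤ |s| := by simpa using abs_sub_left_of_mem_uIcc hq
    exact ⟨abs_lt.1 (h1.trans_lt hsτ), h1⟩
  have hclose : ∀ q ∈ uIcc 0 s, ‖Φ u q - u‖ ≤ B * |q| := by
    intro q hq
    have h1 := (convex_uIcc (0 : ℝ) s).norm_image_sub_le_of_norm_hasDerivWithin_le
      (f := Φ u) (f' := fun t => w (Φ u t)) (C := B)
      (fun t ht => (hΦ u hu2 t (hseg t ht).1).2.1.hasDerivWithinAt)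
      (fun t ht => hB _ (ball_subset_closedBall (hΦ u hu2 t (hseg t ht).1).1))
      left_mem_uIcc hq
    rwa [hΦ0 u hu2, sub_zero, Real.norm_eq_abs] at h1
  have hdist : ∀ q ∈ uIcc 0 s, ‖w (Φ u q) - w y‖ ≤ η' := by
    intro q hq
    rw [← dist_eq_norm]
    refine (hδw _ (ball_subset_closedBall (hΦ u hu2 q (hseg q hq).1).1) _ hyR ?_).le
    have h1 := hclose q hq
    have h2 : B * |q| ≤ |s| * (B + 1) := by nlinarith [(hseg q hq).2, abs_nonneg q, abs_nonneg s]
    rw [mem_ball] at hu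
    have h3 := dist_triangle (Φ u q) u y
    rw [dist_eq_norm (Φ u q) u] at h3
    linarith
  have hmv : ‖Φ u s - (u + s • w y)‖ ≤ η' * |s| := by
    have h1 := (convex_uIcc (0 : ℝ) s).norm_image_sub_le_of_norm_hasDerivWithin_le
      (f := fun t => Φ u t - t • w y) (f' := fun t => w (Φ u t) - w y) (C := η')
      (fun t ht => by
        have h1 := ((hasDerivAt_id t).smul_const (w y))
        rw [one_smul] at h1
        exact ((hΦ u hu2 t (hseg t ht).1).2.1.sub h1).hasDerivWithinAt)
      hdist left_mem_uIcc right_mem_uIcc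
    simp only [zero_smul, sub_zero, hΦ0 u hu2, Real.norm_eq_abs] at h1
    rwa [sub_sub, add_comm (s • w y)] at h1
  have h4 := (hΦ u hu2 s (hseg s right_mem_uIcc).1).2.2
  have h5 := hh.dist_le_mul (u + s • w y) (Φ u s)
  rw [Real.dist_eq, dist_comm (u + s • w y), dist_eq_norm] at h5
  have h6 : L * ‖Φ u s - (u + s • w y)‖ ≤ η * |s| := by
    calc _ ≤ L * (η' * |s|) := by gcongr
      _ = (L * η') * |s| := by ring
      _ ≤ _ := by gcongr
  calc |h (u + s • w y) - h u| ≤ |h (u + s • w y) - h (Φ u s)| + |h (Φ u s) - h u| :=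
        abs_sub_le _ _ _
    _ ≤ η * |s| + c * |s| := add_le_add (h5.trans h6) h4
    _ = _ := by ring

end Mollification

/-! ### Smoothing along a flow on the manifold -/

section ManifoldSmoothing

open Topology Metric

variable {E : Type*} [NormedAddCommGroup E] [NormedSpace ℝ E]
  {M : Type*} [TopologicalSpace M] [ChartedSpace E M]
  {v : (x : M) → TangentSpace 𝓘(ℝ, E) x}

theorem HasMFDerivAt.hasDerivAt_comp_integralCurve {γ : ℝ → M} {t : ℝ}
    (hγ : HasMFDerivAt 𝓘(ℝ, ℝ) 𝓘(ℝ, E) γ t ((1 : ℝ →L[ℝ] ℝ).smulRight (v (γ t)))) {f : M → ℝ}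
    (hf : MDifferentiableAt 𝓘(ℝ, E) 𝓘(ℝ, ℝ) f (γ t)) :
    HasDerivAt (fun s => f (γ s)) (differentialAt f (γ t) (v (γ t))) t := by
  have h3 := (hf.hasMFDerivAt.comp t hγ).hasFDerivAt
  rw [hasDerivAt_iff_hasFDerivAt]
  suffices h5 : ContinuousLinearMap.toSpanSingleton ℝ (differentialAt f (γ t) (v (γ t))) =
      (mfderiv 𝓘(ℝ, E) 𝓘(ℝ, ℝ) f (γ t)).comp ((1 : ℝ →L[ℝ] ℝ).smulRight (v (γ t))) from
    Eq.mpr (congrArg (fun L : ℝ →L[ℝ] ℝ => HasFDerivAt (fun s => f (γ s)) L t) h5) h3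
  refine ContinuousLinearMap.ext fun (c : ℝ) => ?_
  exact (map_smul (mfderiv 𝓘(ℝ, E) 𝓘(ℝ, ℝ) f (γ t)) c (v (γ t))).symm

theorem hasDerivAt_comp_flow {φ : M → ℝ → M}
    (hφ : ∀ x, φ x 0 = x ∧ IsMIntegralCurve (φ x) v) {f : M → ℝ} {x : M}
    (hf : MDifferentiableAt 𝓘(ℝ, E) 𝓘(ℝ, ℝ) f x) :
    HasDerivAt (fun s => f (φ x s)) (differentialAt f x (v x)) 0 := by
  have h := ((hφ x).2 0).hasDerivAt_comp_integralCurve (f := f) (by rwa [(hφ x).1])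
  rwa [(hφ x).1] at h

variable [IsManifold 𝓘(ℝ, E) ∞ M]

theorem differentialAt_eq_fderiv_chartField {f : M → ℝ} {c x : M}
    (hx : x ∈ (chartAt E c).source) (hf : MDifferentiableAt 𝓘(ℝ, E) 𝓘(ℝ, ℝ) f x) :
    differentialAt f x (v x) =
      fderiv ℝ (f ∘ (chartAt E c).symm) (chartAt E c x) (chartField v c (chartAt E c x)) := by
  have : IsManifold 𝓘(ℝ, E) 1 M := IsManifold.of_le (n := ∞) (by norm_cast)
  set e := chartAt E c
  obtain ⟨u, hu, rfl⟩ : ∃ u ∈ e.target, x = e.symm u :=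
    ⟨e x, e.map_source hx, (e.left_inv hx).symm⟩
  rw [e.right_inv hu, ← mfderiv_eq_fderiv]
  have h2 : MDifferentiableAt 𝓘(ℝ, E) 𝓘(ℝ, E) e.symm u :=
    (mdifferentiable_chart (I := 𝓘(ℝ, E)) c).mdifferentiableAt_symm hu
  rw [mfderiv_comp u hf h2]
  change mfderiv 𝓘(ℝ, E) 𝓘(ℝ, ℝ) f (e.symm u) (v (e.symm u)) =
    mfderiv 𝓘(ℝ, E) 𝓘(ℝ, ℝ) f (e.symm u)
      (mfderiv 𝓘(ℝ, E) 𝓘(ℝ, E) e.symm u (chartField (E := E) v c u))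
  rw [mfderiv_chartAt_symm_chartField v c hu]

theorem continuous_differentialAt_apply
    (hv : ∀ x₀, ContDiffOn ℝ 1 (chartField v x₀) (chartAt E x₀).target) {f : M → ℝ}
    (hf : ContMDiff 𝓘(ℝ, E) 𝓘(ℝ, ℝ) ∞ f) :
    Continuous fun x => differentialAt f x (v x) := by
  have : IsManifold 𝓘(ℝ, E) 1 M := IsManifold.of_le (n := ∞) (by norm_cast)
  rw [continuous_iff_continuousAt]
  intro c
  set e := chartAt E c
  have hc := mem_chart_source E c
  have hg : ContDiffOn ℝ ∞ (f ∘ e.symm) e.target := by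
    rw [← contMDiffOn_iff_contDiffOn]
    exact hf.comp_contMDiffOn (contMDiffOn_chart_symm (I := 𝓘(ℝ, E)))
  have hdg : ContinuousOn (fderiv ℝ (f ∘ e.symm)) e.target :=
    hg.continuousOn_fderiv_of_isOpen e.open_target (by simp)
  have htgt := e.open_target.mem_nhds (mem_chart_target E c)
  have h1 : ContinuousAt (fun u => fderiv ℝ (f ∘ e.symm) u (chartField v c u)) (e c) :=
    (hdg.continuousAt htgt).clm_apply ((hv c).continuousOn.continuousAt htgt)
  refine ContinuousAt.congr (h1.comp (e.continuousAt hc)) ?_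
  filter_upwards [e.open_source.mem_nhds hc] with x hx
  exact (differentialAt_eq_fderiv_chartField hx
    ((hf x).mdifferentiableAt (by simp))).symm

variable [FiniteDimensional ℝ E] [T2Space M] {φ : M → ℝ → M}

/-- Local smoothing of a locally Lipschitz function with bounded increments along a flow. -/
theorem exists_local_smoothing
    (hv : ∀ x₀, ContDiffOn ℝ 1 (chartField v x₀) (chartAt E x₀).target)
    (hφ : ∀ x, φ x 0 = x ∧ IsMIntegralCurve (φ x) v) {H : M → ℝ} {c : ℝ} (hc : 0 ≤ c)
    {x₀ : M} (hlip : LipschitzNear E H x₀ x₀) (hinc : ∀ x t, |H (φ x t) - H x| ≤ c * |t|) :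
    ∃ V, IsOpen V ∧ x₀ ∈ V ∧ (∃ Q, IsCompact Q ∧ V ⊆ Q) ∧ ∀ η > 0, ∃ g : M → ℝ,
      ∀ x ∈ V, ContMDiffAt 𝓘(ℝ, E) 𝓘(ℝ, ℝ) ∞ g x ∧ |g x - H x| ≤ η ∧
        |differentialAt g x (v x)| ≤ c + η := by
  set e := chartAt E x₀
  have hx₀ := mem_chart_source E x₀
  have htgt := e.open_target.mem_nhds (mem_chart_target E x₀)
  have hpre {N : Set M} (hN : N ∈ 𝓝 x₀) : e.symm ⁻¹' N ∈ 𝓝 (e x₀) := by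
    refine e.continuousAt_symm (mem_chart_target E x₀) ?_
    rwa [e.left_inv hx₀]
  obtain ⟨U, hU, K, hK, hUK⟩ := hlip
  obtain ⟨R, hR, hRsub⟩ := nhds_basis_closedBall.mem_iff.1 (Filter.inter_mem htgt (hpre hU))
  obtain ⟨W, hW, τ, hτ, -, hWN, -⟩ := flow_local_lipschitz hv hφ x₀
    (N := e.source ∩ e ⁻¹' ball (e x₀) R) (Filter.inter_mem (e.open_source.mem_nhds hx₀)
      (e.continuousAt hx₀ (ball_mem_nhds _ hR)))
  obtain ⟨ρ, hρ, hρsub⟩ := nhds_basis_ball.mem_iff.1 (Filter.inter_mem htgt (hpre hW))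
  set r := min R ρ / 2 with hr
  have hr0 : 0 < r := by positivity
  have h2r : 2 * r = min R ρ := by rw [hr]; ring
  have hLip : LipschitzOnWith ⟨K, hK⟩ (H ∘ e.symm) (ball (e x₀) R) := by
    refine LipschitzOnWith.of_dist_le_mul fun a ha b hb => ?_
    have ha' := hRsub (ball_subset_closedBall ha)
    have hb' := hRsub (ball_subset_closedBall hb)
    have h := hUK _ ha'.2 _ hb'.2
    rw [e.right_inv ha'.1, e.right_inv hb'.1] at h
    rw [dist_eq_norm, dist_eq_norm]
    exact h
  -- The mollifier works with a function on all of `E`; the extension keeps the Lipschitz constant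
  -- and agrees with `H` where the flow increments are used.
  obtain ⟨h, hh, hhH⟩ := hLip.extend_real
  have hball : ball (e x₀) (2 * r) ⊆ ball (e x₀) ρ := ball_subset_ball (h2r ▸ min_le_right _ _)
  have hballR : ball (e x₀) (2 * r) ⊆ ball (e x₀) R := ball_subset_ball (h2r ▸ min_le_left _ _)
  refine ⟨e.source ∩ e ⁻¹' ball (e x₀) r, e.isOpen_inter_preimage isOpen_ball,
    ⟨hx₀, mem_ball_self hr0⟩, ⟨e.symm '' closedBall (e x₀) R,
      (isCompact_closedBall _ _).image_of_continuousOn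
        (e.continuousOn_symm.mono fun a ha => (hRsub ha).1), fun x hx => ⟨e x, ?_, e.left_inv hx.1⟩⟩,
    fun η hη => ?_⟩
  · exact ball_subset_closedBall (hballR (ball_subset_ball (by linarith) hx.2))
  obtain ⟨g, hg, hgh, hgd⟩ := hh.exists_contDiff_approx_of_flow (w := chartField v x₀)
    (y₀ := e x₀) (r := r) (R := R) (τ := τ) (c := c) hr0 hτ (h2r ▸ min_le_left _ _) hc
    ((hv x₀).continuousOn.mono fun a ha => (hRsub ha).1)
    (Φ := fun u t => e (φ (e.symm u) t))
    (fun u hu => by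
      rw [(hφ _).1, e.right_inv (hρsub (hball hu)).1])
    (fun u hu t ht => by
      have hmem := hWN _ (hρsub (hball hu)).2 t ht
      refine ⟨hmem.2, ((hφ (e.symm u)).2 t).hasDerivAt_chartAt_comp x₀ hmem.1, ?_⟩
      rw [← hhH hmem.2, ← hhH (hballR hu), Function.comp_apply, Function.comp_apply,
        e.left_inv hmem.1]
      exact hinc _ _) hη
  refine ⟨g ∘ e, fun x hx => ?_⟩
  have hsm : ContMDiffAt 𝓘(ℝ, E) 𝓘(ℝ, ℝ) ∞ (g ∘ e) x :=
    ContMDiffAt.comp x hg.contMDiff.contMDiffAt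
      (contMDiffAt_of_mem_maximalAtlas (IsManifold.chart_mem_maximalAtlas x₀) hx.1)
  refine ⟨hsm, ?_, ?_⟩
  · have h1 := hgh (e x)
    rwa [← hhH (hballR (ball_subset_ball (by linarith) hx.2)), Function.comp_apply,
      e.left_inv hx.1] at h1
  · rw [differentialAt_eq_fderiv_chartField hx.1 (hsm.mdifferentiableAt (by simp))]
    have h2 : (g ∘ e) ∘ e.symm =ᶠ[𝓝 (e x)] g := by
      filter_upwards [e.open_target.mem_nhds (e.map_source hx.1)] with u hu
      simp [e.right_inv hu]
    rw [h2.fderiv_eq]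
    exact hgd _ hx.2

/-- Global smoothing, on a compact set, of a locally Lipschitz function with bounded increments
along a flow. -/
theorem exists_smoothing [SigmaCompactSpace M]
    (hv : ∀ x₀, ContDiffOn ℝ 1 (chartField v x₀) (chartAt E x₀).target)
    (hφ : ∀ x, φ x 0 = x ∧ IsMIntegralCurve (φ x) v) {H : M → ℝ} {c : ℝ} (hc : 0 ≤ c)
    (hlip : ∀ x, LipschitzNear E H x x) (hinc : ∀ x t, |H (φ x t) - H x| ≤ c * |t|)
    {K : Set M} (hK : IsCompact K) {η : ℝ} (hη : 0 < η) :
    ∃ g ∈ SymplecticForm.testFunctions E M,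
      ∀ x ∈ K, |g x - H x| ≤ η ∧ |differentialAt (E := E) g x (v x)| ≤ c + η := by
  have : LocallyCompactSpace M := ChartedSpace.locallyCompactSpace E M
  choose V hVo hxV hVQ hV using fun x₀ => exists_local_smoothing hv hφ hc (hlip x₀) hinc
  obtain ⟨f, hf⟩ := SmoothPartitionOfUnity.exists_isSubordinate 𝓘(ℝ, E) isClosed_univ V hVo
    (fun x _ => mem_iUnion_of_mem x (hxV x))
  -- The finite sum of the partition functions must be `1` on a neighbourhood of `K`, so that its
  -- derivative along `v` vanishes on `K`.
  obtain ⟨K', hK', hKK'⟩ := exists_compact_superset hK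
  have hfin := f.locallyFinite.finite_nonempty_inter_compact hK'
  set s := hfin.toFinset with hs
  have hsum : ∀ x ∈ K', ∑ i ∈ s, f i x = 1 := by
    intro x hx
    rw [← f.sum_eq_one (mem_univ x)]
    refine (finsum_eq_sum_of_support_subset _ fun i hi => ?_).symm
    rw [hs, Finite.coe_toFinset]
    exact ⟨x, hi, hx⟩
  have hD : ∀ i, ∃ D, ∀ x ∈ K, ‖differentialAt (E := E) (f i) x (v x)‖ ≤ D := fun i =>
    hK.exists_bound_of_continuousOn
      (continuous_differentialAt_apply hv (f i).contMDiff).continuousOn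
  choose D hD using hD
  set B := ∑ i ∈ s, |D i| with hB
  have hB0 : 0 ≤ B := Finset.sum_nonneg fun i _ => abs_nonneg _
  set η' := η / (B + 1) with hη'
  have hη'0 : 0 < η' := by positivity
  have hη'B : B * η' + η' ≤ η := by
    rw [hη', mul_div_assoc', ← add_div, div_le_iff₀ (by positivity)]
    nlinarith
  have hη'η : η' ≤ η := by nlinarith
  choose g hg using fun i => hV i η' hη'0
  have hsub (i) {x} (hx : x ∈ tsupport (f i)) : x ∈ V i := hf i hx
  refine ⟨fun x => ∑ i ∈ s, f i x * g i x, ⟨?_, ?_⟩, fun x hx => ⟨?_, ?_⟩⟩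
  · refine contMDiff_finsetSum fun i _ => ?_
    exact f.contMDiff_smul fun x hx => (hg i x (hsub i hx)).1
  · have hQ (i : M) : HasCompactSupport (f i) := by
      obtain ⟨Q, hQ, hVQ⟩ := hVQ i
      exact hQ.of_isClosed_subset (isClosed_tsupport _) ((hf i).trans hVQ)
    refine HasCompactSupport.intro (K := ⋃ i ∈ s, tsupport (f i))
      (s.isCompact_biUnion fun i _ => hQ i) fun x hx => Finset.sum_eq_zero fun i hi => ?_
    rw [image_eq_zero_of_notMem_tsupport (fun h => hx (mem_biUnion hi h)), zero_mul]
  · have h1 : ∑ i ∈ s, f i x * g i x - H x = ∑ i ∈ s, f i x * (g i x - H x) := by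
      simp only [mul_sub, Finset.sum_sub_distrib]
      rw [← Finset.sum_mul, hsum x (interior_subset (hKK' hx)), one_mul]
    rw [h1]
    calc _ ≤ ∑ i ∈ s, |f i x * (g i x - H x)| := Finset.abs_sum_le_sum_abs _ _
      _ ≤ ∑ i ∈ s, f i x * η' := by
        refine Finset.sum_le_sum fun i _ => ?_
        rw [abs_mul, abs_of_nonneg (f.nonneg i x)]
        by_cases hxi : x ∈ tsupport (f i)
        · exact mul_le_mul_of_nonneg_left (hg i x (hsub i hxi)).2.1 (f.nonneg i x)
        · rw [image_eq_zero_of_notMem_tsupport hxi, zero_mul, zero_mul]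
      _ = η' := by rw [← Finset.sum_mul, hsum x (interior_subset (hKK' hx)), one_mul]
      _ ≤ η := hη'η
  · have hgi (i) : f i x ≠ 0 → |differentialAt (E := E) (g i) x (v x)| ≤ c + η' := fun h =>
      (hg i x (hsub i (subset_tsupport _ h))).2.2
    have hmd (i) : MDifferentiableAt 𝓘(ℝ, E) 𝓘(ℝ, ℝ) (f i) x :=
      ((f i).contMDiff x).mdifferentiableAt (by simp)
    set d : M → ℝ := fun i => differentialAt (E := E) (f i) x (v x) with hd
    set d' : M → ℝ := fun i => differentialAt (E := E) (g i) x (v x) with hd'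
    have hfd (i) : HasDerivAt (fun t => f i (φ x t)) (d i) 0 := hasDerivAt_comp_flow hφ (hmd i)
    have hterm (i) : HasDerivAt (fun t => f i (φ x t) * g i (φ x t))
        (d i * g i x + f i x * d' i) 0 ∧ (x ∉ tsupport (f i) → d i = 0) := by
      by_cases hxi : x ∈ tsupport (f i)
      · have h1 := (hfd i).mul (hasDerivAt_comp_flow hφ
          ((hg i x (hsub i hxi)).1.mdifferentiableAt (by simp)))
        simp only [(hφ x).1] at h1
        exact ⟨h1, fun h => absurd hxi h⟩
      · have h0 : (fun t => f i (φ x t)) =ᶠ[𝓝 0] fun _ => 0 := by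
          have hcont := (hφ x).2.continuous.continuousAt (x := 0)
          filter_upwards [hcont ((isClosed_tsupport (f i)).isOpen_compl.mem_nhds
            (by rwa [(hφ x).1]))] with t ht
          exact image_eq_zero_of_notMem_tsupport ht
        have hd0 : d i = 0 := ((hasDerivAt_const (0 : ℝ) (0 : ℝ)).congr_of_eventuallyEq h0).unique
          (hfd i) |>.symm
        refine ⟨?_, fun _ => hd0⟩
        rw [hd0, image_eq_zero_of_notMem_tsupport hxi, zero_mul, zero_mul, add_zero]
        refine (hasDerivAt_const (0 : ℝ) (0 : ℝ)).congr_of_eventuallyEq ?_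
        filter_upwards [h0] with t ht
        simp [ht]
    have hsm : MDifferentiableAt 𝓘(ℝ, E) 𝓘(ℝ, ℝ) (fun x => ∑ i ∈ s, f i x * g i x) x := by
      refine ContMDiffAt.mdifferentiableAt (n := ∞) ?_ (by simp)
      exact (contMDiff_finsetSum fun i _ =>
        f.contMDiff_smul fun x hx => (hg i x (hsub i hx)).1).contMDiffAt
    have hder : differentialAt (E := E) (fun x => ∑ i ∈ s, f i x * g i x) x (v x) =
        ∑ i ∈ s, (d i * g i x + f i x * d' i) :=
      (hasDerivAt_comp_flow hφ hsm).unique (HasDerivAt.fun_sum fun i _ => (hterm i).1)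
    have hdsum : ∑ i ∈ s, d i = 0 := by
      have h1 : HasDerivAt (fun t => ∑ i ∈ s, f i (φ x t)) (∑ i ∈ s, d i) 0 :=
        HasDerivAt.fun_sum fun i _ => hfd i
      refine h1.unique ((hasDerivAt_const (0 : ℝ) (1 : ℝ)).congr_of_eventuallyEq ?_)
      have hcont := (hφ x).2.continuous.continuousAt (x := 0)
      filter_upwards [hcont (isOpen_interior.mem_nhds (by rw [(hφ x).1]; exact hKK' hx))] with t ht
      exact hsum _ (interior_subset ht)
    -- Since the `d i` sum to zero, `g i x` may be replaced by the small difference `g i x - H x`.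
    -- The terms containing derivatives of the partition then cost at most `B * η'`, and `H` itself
    -- is never differentiated.
    have h2 : ∑ i ∈ s, (d i * g i x + f i x * d' i) =
        ∑ i ∈ s, (d i * (g i x - H x) + f i x * d' i) := by
      have : ∑ i ∈ s, d i * H x = 0 := by rw [← Finset.sum_mul, hdsum, zero_mul]
      simp only [mul_sub, Finset.sum_add_distrib, Finset.sum_sub_distrib, this, sub_zero]
    rw [hder, h2]
    calc _ ≤ ∑ i ∈ s, |d i * (g i x - H x) + f i x * d' i| := Finset.abs_sum_le_sum_abs _ _
      _ ≤ ∑ i ∈ s, (|D i| * η' + f i x * (c + η')) := by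
        refine Finset.sum_le_sum fun i _ => (abs_add_le _ _).trans (add_le_add ?_ ?_)
        · rw [abs_mul]
          by_cases hxi : x ∈ tsupport (f i)
          · exact mul_le_mul ((hD i x hx).trans (le_abs_self _)) (hg i x (hsub i hxi)).2.1
              (abs_nonneg _) (abs_nonneg _)
          · rw [(hterm i).2 hxi, abs_zero, zero_mul]
            positivity
        · rw [abs_mul, abs_of_nonneg (f.nonneg i x)]
          by_cases hfi : f i x = 0
          · rw [hfi, zero_mul, zero_mul]
          · exact mul_le_mul_of_nonneg_left (hgi i hfi) (f.nonneg i x)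
      _ = B * η' + (c + η') := by
        rw [Finset.sum_add_distrib, ← Finset.sum_mul, ← Finset.sum_mul,
          hsum x (interior_subset (hKK' hx)), one_mul]
      _ ≤ c + η := by linarith

end ManifoldSmoothing

/-! ### Separating two sets that no short trajectory joins -/

section Separation

open Topology Metric intervalIntegral

variable {E : Type*} [NormedAddCommGroup E] [NormedSpace ℝ E] [FiniteDimensional ℝ E]
  {M : Type*} [TopologicalSpace M] [ChartedSpace E M] [IsManifold 𝓘(ℝ, E) ∞ M]
  [T2Space M] {v : (x : M) → TangentSpace 𝓘(ℝ, E) x}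

/-- If no integral curve of `v` of length at most `p` joins the compact sets `A` and `B`, then `A`
and `B` are separated by a smooth compactly supported function whose derivative along `v` is
bounded by any given `c > 1 / p` on a given compact set. -/
theorem exists_separating_function [SigmaCompactSpace M]
    (hv : ∀ x₀, ContDiffOn ℝ 1 (chartField v x₀) (chartAt E x₀).target)
    {C : Set M} (hC : IsCompact C) (hvC : ∀ x ∉ C, v x = 0)
    {A B : Set M} (hA : IsCompact A) (hB : IsCompact B) {p : ℝ} (hp : 0 < p)
    (hAB : ∀ γ : ℝ → M, IsMIntegralCurve γ v → ∀ t, |t| ≤ p → γ 0 ∈ A → γ t ∉ B)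
    {c : ℝ} (hc : 1 / p < c) :
    ∃ g ∈ SymplecticForm.testFunctions E M, (∀ x ∈ A, g x ≤ 0) ∧ (∀ x ∈ B, 1 ≤ g x) ∧
      ∀ x ∈ C, |differentialAt (E := E) g x (v x)| ≤ c := by
  obtain ⟨φ, hφ⟩ := exists_global_flow hv hC hvC
  have hcont := continuous_flow hv hφ
  have hIcc : IsCompact (Icc (-(p / 2)) (p / 2)) := isCompact_Icc
  set A' := Function.uncurry φ '' (A ×ˢ Icc (-(p / 2)) (p / 2))
  set B' := Function.uncurry φ '' (B ×ˢ Icc (-(p / 2)) (p / 2))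
  have hA' : IsClosed A' := ((hA.prod hIcc).image hcont).isClosed
  have hB' : IsClosed B' := ((hB.prod hIcc).image hcont).isClosed
  -- A common point reached from `A` in time `s` and from `B` in time `t` gives a curve from `A` to
  -- `B` of length `|s - t| ≤ p`; hence the half-windows `p / 2`.
  have hdisj : Disjoint A' B' := by
    rw [Set.disjoint_left]
    rintro _ ⟨⟨a, s⟩, ⟨ha, hs⟩, rfl⟩ ⟨⟨b, t⟩, ⟨hb, ht⟩, hab⟩
    refine hAB (φ a) (hφ a).2 (s - t) ?_ (by rwa [(hφ a).1]) ?_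
    · rw [abs_le]
      constructor <;> linarith [hs.1, hs.2, ht.1, ht.2]
    · have h1 := congrArg (fun y => φ y (-t)) hab
      simp only [Function.uncurry_apply_pair] at h1
      rw [flow_add hv hφ, flow_add hv hφ, neg_add_cancel, (hφ b).1, neg_add_eq_sub] at h1
      rwa [← h1]
  obtain ⟨f, hf0, hf1, hf01⟩ :=
    exists_contMDiffMap_zero_one_of_isClosed 𝓘(ℝ, E) (n := ⊤) hA' hB' hdisj
  have hfφ (x : M) : Continuous fun t => f (φ x t) :=
    f.contMDiff.continuous.comp (hφ x).2.continuous
  have hint (x : M) (a b : ℝ) :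
      IntervalIntegrable (fun t => f (φ x t)) MeasureTheory.volume a b :=
    (hfφ x).intervalIntegrable a b
  set I : M → ℝ := fun x => ∫ t in -(p / 2)..p / 2, f (φ x t) with hI
  have hIA : ∀ x ∈ A, I x = 0 := by
    intro x hx
    rw [hI]
    refine (integral_congr (g := fun _ => (0 : ℝ)) fun t ht => ?_).trans integral_zero
    rw [uIcc_of_le (by linarith)] at ht
    exact hf0 ⟨(x, t), ⟨hx, ht⟩, rfl⟩
  have hIB : ∀ x ∈ B, I x = p := by
    intro x hx
    rw [hI]
    refine (integral_congr (g := fun _ => (1 : ℝ)) fun t ht => ?_).trans ?_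
    · rw [uIcc_of_le (by linarith)] at ht
      exact hf1 ⟨(x, t), ⟨hx, ht⟩, rfl⟩
    · rw [integral_const, smul_eq_mul]; ring
  have hIlip (x : M) : LipschitzNear E I x x := by
    obtain ⟨U, hU, K, hK, h⟩ := exists_lipschitz_comp_flow hv hφ
      (f.contMDiff.of_le (by norm_cast)) x hIcc
    refine ⟨U, hU, K * p, by positivity, fun y hy z hz => ?_⟩
    rw [hI, ← integral_sub (hint y _ _) (hint z _ _)]
    calc _ ≤ K * ‖chartAt E x y - chartAt E x z‖ * |p / 2 - -(p / 2)| := by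
          refine norm_integral_le_of_norm_le_const fun t ht => ?_
          rw [uIoc_of_le (by linarith)] at ht
          exact h t (Ioc_subset_Icc_self ht) y hy z hz
      _ = _ := by
          rw [abs_of_nonneg (by linarith)]
          ring
  -- Moving along the flow shifts the integration window, so only its two ends contribute; the
  -- difference of two values of `f` lies in `[-1, 1]`.
  have hIinc (x : M) (s : ℝ) : |I (φ x s) - I x| ≤ |s| := by
    have h1 : I (φ x s) = ∫ t in -(p / 2) + s..p / 2 + s, f (φ x t) := by
      rw [hI, ← integral_comp_add_right (fun t => f (φ x t))]
      simp only [flow_add hv hφ]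
    have h2 : I (φ x s) - I x =
        (∫ t in p / 2..p / 2 + s, f (φ x t)) - ∫ t in -(p / 2)..-(p / 2) + s, f (φ x t) := by
      rw [h1, hI, integral_interval_sub_interval_comm (hint x _ _) (hint x _ _) (hint x _ _),
        integral_symm, integral_symm (p / 2) (p / 2 + s)]
      ring
    have h3 (a : ℝ) : ∫ t in a..a + s, f (φ x t) = ∫ t in (0 : ℝ)..s, f (φ x (t + a)) := by
      rw [integral_comp_add_right (fun t => f (φ x t)), zero_add, add_comm s a]
    have hint' (a : ℝ) :
        IntervalIntegrable (fun t => f (φ x (t + a))) MeasureTheory.volume 0 s :=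
      ((hfφ x).comp (continuous_add_const a)).intervalIntegrable _ _
    rw [h2, h3, h3, ← integral_sub (hint' _) (hint' _), ← Real.norm_eq_abs]
    have h4 := norm_integral_le_of_norm_le_const (a := 0) (b := s) (C := 1)
      (f := fun t => f (φ x (t + p / 2)) - f (φ x (t + -(p / 2)))) fun t _ => by
        rw [Real.norm_eq_abs, abs_le]
        constructor <;> linarith [(hf01 (φ x (t + p / 2))).1, (hf01 (φ x (t + p / 2))).2,
          (hf01 (φ x (t + -(p / 2)))).1, (hf01 (φ x (t + -(p / 2)))).2]
    simpa using h4
  have hp1 : 0 < 1 / p := by positivity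
  -- This `η` solves `(1 + 2 * η) / p + η = c`. The function `k * I - η` is then `-η` on `A` and `1
  -- + η` on `B`, leaving room for a smoothing error `η` in the values and in the derivative.
  set η := (c - 1 / p) / (2 * (1 / p) + 1) with hη
  have hη0 : 0 < η := div_pos (by linarith) (by positivity)
  have hηc : (1 + 2 * η) * (1 / p) + η = c := by
    have h1 : η * (2 * (1 / p) + 1) = c - 1 / p := by rw [hη, div_mul_cancel₀ _ (by positivity)]
    linarith
  set k := (1 + 2 * η) * (1 / p) with hk
  have hk0 : 0 ≤ k := by positivity
  have hkp : k * p = 1 + 2 * η := by rw [hk]; field_simp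
  have hsub (y z : M) : (k * I y - η) - (k * I z - η) = k * (I y - I z) := by ring
  obtain ⟨g, hg, hgK⟩ := exists_smoothing hv hφ (H := fun x => k * I x - η) (c := k) hk0
    (fun x => by
      obtain ⟨U, hU, K, hK, h⟩ := hIlip x
      refine ⟨U, hU, k * K, by positivity, fun y hy z hz => ?_⟩
      rw [hsub, norm_mul, Real.norm_of_nonneg hk0, mul_assoc k K]
      exact mul_le_mul_of_nonneg_left (h y hy z hz) hk0)
    (fun x t => by
      rw [hsub, abs_mul, abs_of_nonneg hk0]
      exact mul_le_mul_of_nonneg_left (hIinc x t) hk0)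
    ((hA.union hB).union hC) hη0
  refine ⟨g, hg, fun x hx => ?_, fun x hx => ?_, fun x hx => hηc ▸ (hgK x (Or.inr hx)).2⟩
  · have h1 := (hgK x (Or.inl (Or.inl hx))).1
    rw [hIA x hx, mul_zero, abs_le] at h1
    linarith [h1.2]
  · have h1 := (hgK x (Or.inl (Or.inr hx))).1
    rw [hIB x hx, hkp, abs_le] at h1
    linarith [h1.1]

end Separation

/-! ### The one-variable cutoff profile -/

section Profile

open Metric MeasureTheory intervalIntegral

/-- A smooth function which is `0` on `(-∞, 0]`, `1` near `[1, ∞)` and has derivative at most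
`m > 1`. -/
theorem exists_smooth_ramp {m : ℝ} (hm : 1 < m) :
    ∃ r : ℝ → ℝ, ContDiff ℝ ∞ r ∧ (∀ t ≤ 0, r t = 0) ∧ (∃ δ > 0, ∀ t, 1 - δ ≤ t → r t = 1) ∧
      (∀ t, 0 ≤ r t ∧ r t ≤ 1) ∧ ∀ t, |deriv r t| ≤ m := by
  have hm0 : 0 < m := by linarith
  have hm1 : 1 / m < 1 := by rw [div_lt_one hm0]; exact hm
  have hmp : 0 < 1 / m := by positivity
  -- The inner interval has length `1 / m`, so the normalized bump is at most `m`. The outer radius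
  -- is the midpoint of `1 / (2 * m)` and `1 / 2`, which keeps the support strictly inside `(0, 1)`.
  let b : ContDiffBump (1 / 2 : ℝ) := ⟨1 / (2 * m), (1 + 1 / m) / 4, by positivity, by
    rw [show 1 / (2 * m) = (1 / m) / 2 by field_simp]; linarith⟩
  set ρ := b.normed volume
  have hρ : Continuous ρ := b.continuous_normed
  have hout : b.rOut = (1 + 1 / m) / 4 := rfl
  have hρ0 (t : ℝ) : 0 ≤ ρ t := b.nonneg_normed t
  have hint (a b : ℝ) : IntervalIntegrable ρ volume a b := hρ.intervalIntegrable a b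
  have hzero (t : ℝ) (ht : (1 + 1 / m) / 4 ≤ |t - 1 / 2|) : ρ t = 0 := by
    rw [← Function.notMem_support, b.support_normed_eq, mem_ball, Real.dist_eq, hout, not_lt]
    exact ht
  set r : ℝ → ℝ := fun t => ∫ s in (0 : ℝ)..t, ρ s with hr
  have hderiv (t : ℝ) : HasDerivAt r (ρ t) t :=
    integral_hasDerivAt_right (hint _ _) hρ.stronglyMeasurable.stronglyMeasurableAtFilter
      hρ.continuousAt
  have hneg : ∀ t ≤ 0, r t = 0 := by
    intro t ht
    refine (integral_congr (g := fun _ => (0 : ℝ)) fun s hs => hzero s ?_).trans integral_zero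
    rw [uIcc_of_ge ht] at hs
    rw [abs_of_nonpos (by linarith [hs.2])]
    linarith [hs.2]
  have hmono : Monotone r := monotone_of_hasDerivAt_nonneg hderiv hρ0
  have htot : ∫ s, ρ s = 1 := b.integral_normed
  have hone : ∀ t, 1 - (1 - 1 / m) / 4 ≤ t → r t = 1 := by
    intro t ht
    rw [hr, ← htot]
    refine integral_eq_integral_of_support_subset fun s hs => ?_
    by_contra h
    refine hs (hzero s ?_)
    rw [mem_Ioc, not_and_or, not_lt, not_le] at h
    rcases h with h | h
    · rw [abs_of_nonpos (by linarith)]; linarith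
    · rw [abs_of_nonneg (by linarith)]; linarith
  refine ⟨r, ?_, hneg, ⟨_, by linarith, hone⟩, fun t => ⟨?_, ?_⟩, fun t => ?_⟩
  · rw [contDiff_infty_iff_deriv]
    refine ⟨fun t => (hderiv t).differentiableAt, ?_⟩
    rw [show deriv r = ρ from funext fun t => (hderiv t).deriv]
    exact b.contDiff_normed (n := ⊤)
  · rw [← hneg _ (min_le_right t 0)]
    exact hmono (min_le_left t 0)
  · rw [← hone _ (le_max_right t _)]
    exact hmono (le_max_left t _)
  · rw [(hderiv t).deriv, abs_of_nonneg (hρ0 t)]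
    refine (b.normed_le_div_measure_closedBall_rIn volume t).trans ?_
    have hin : b.rIn = 1 / (2 * m) := rfl
    rw [measureReal_def, Real.volume_closedBall, hin, ENNReal.toReal_ofReal (by positivity)]
    apply le_of_eq
    field_simp

/-- A smooth decreasing profile `w`, equal to `1` on `(-∞, 0]` and to `0` near `[1, ∞)`, for which
`|w w'|` is at most a given `c > 1 / 2`. -/
theorem exists_profile {c : ℝ} (hc : 1 / 2 < c) :
    ∃ w : ℝ → ℝ, ContDiff ℝ ∞ w ∧ (∀ t ≤ 0, w t = 1) ∧ (∃ δ > 0, ∀ t, 1 - δ ≤ t → w t = 0) ∧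
      (∀ t, 0 ≤ w t) ∧ ∀ t, |deriv w t * w t| ≤ c := by
  -- The shift `k` removes the singularity of `√(1 - t)` at `1`. The profile `(√(1 - r + k) - √k) /
  -- D` has `|w w'| ≤ |r'| / (2 * D ^ 2)`, so a ramp `r` of slope at most `2 * c * D ^ 2` is wanted;
  -- this exceeds `1` for small `k` because `D` tends to `1`.
  obtain ⟨k, hk0, hk⟩ : ∃ k > 0, 1 < 2 * c * (Real.sqrt (1 + k) - Real.sqrt k) ^ 2 := by
    have hcont : ContinuousAt
        (fun k : ℝ => 2 * c * (Real.sqrt (1 + k) - Real.sqrt k) ^ 2) 0 := by fun_prop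
    have h1 : ∀ᶠ k in nhds (0 : ℝ), 1 < 2 * c * (Real.sqrt (1 + k) - Real.sqrt k) ^ 2 := by
      refine hcont.eventually (lt_mem_nhds ?_)
      simp only [add_zero, Real.sqrt_one, Real.sqrt_zero, sub_zero, one_pow, mul_one]
      linarith
    obtain ⟨k, hk, hk0⟩ := ((h1.filter_mono (nhdsWithin_le_nhds (s := Ioi 0))).and
      self_mem_nhdsWithin).exists
    exact ⟨k, hk0, hk⟩
  set D := Real.sqrt (1 + k) - Real.sqrt k with hD
  have hD0 : 0 < D := sub_pos.2 (Real.sqrt_lt_sqrt hk0.le (by linarith))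
  obtain ⟨r, hr, hr0, ⟨δ, hδ, hr1⟩, hr01, hrd⟩ := exists_smooth_ramp hk
  set S : ℝ → ℝ := fun t => Real.sqrt (1 - r t + k) with hS
  have hpos (t : ℝ) : 0 < 1 - r t + k := by linarith [(hr01 t).2]
  have hSpos (t : ℝ) : 0 < S t := Real.sqrt_pos.2 (hpos t)
  have hSk (t : ℝ) : Real.sqrt k ≤ S t := Real.sqrt_le_sqrt (by linarith [(hr01 t).2])
  have hSd (t : ℝ) : HasDerivAt S (-deriv r t / (2 * S t)) t := by
    have h1 : HasDerivAt (fun t => 1 - r t + k) (-deriv r t) t :=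
      ((hr.differentiable (by simp) t).hasDerivAt.const_sub 1).add_const k
    exact h1.sqrt (hpos t).ne'
  refine ⟨fun t => (S t - Real.sqrt k) / D, ?_, fun t ht => ?_, ⟨δ, hδ, fun t ht => ?_⟩,
    fun t => div_nonneg (sub_nonneg.2 (hSk t)) hD0.le, fun t => ?_⟩
  · exact (((((contDiff_const.sub hr).add contDiff_const).sqrt fun t => (hpos t).ne').sub
      contDiff_const)).div_const D
  · simp only [hS, hr0 t ht, sub_zero]
    exact div_self hD0.ne'
  · simp only [hS, hr1 t ht, sub_self, zero_add, zero_div]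
  · rw [(((hSd t).sub_const _).div_const D).deriv]
    have h1 : 0 ≤ (S t - Real.sqrt k) / D := div_nonneg (sub_nonneg.2 (hSk t)) hD0.le
    have h2 : (S t - Real.sqrt k) / D ≤ S t / D := by
      gcongr
      linarith [Real.sqrt_nonneg k]
    have hS0 := hSpos t
    rw [abs_mul, abs_of_nonneg h1]
    calc _ ≤ |-deriv r t / (2 * S t) / D| * (S t / D) := by gcongr
      _ = |deriv r t| / (2 * D ^ 2) := by
        rw [abs_div, abs_div, abs_neg, abs_of_pos hD0, abs_of_pos (by positivity : 0 < 2 * S t)]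
        field_simp
      _ ≤ 2 * c * D ^ 2 / (2 * D ^ 2) := by gcongr; exact hrd t
      _ = c := by field_simp

end Profile

/-! ### The Poisson bracket estimate -/

namespace SymplecticForm

variable {E : Type*} [NormedAddCommGroup E] [NormedSpace ℝ E]
  {M : Type*} [TopologicalSpace M] [ChartedSpace E M]

theorem differentialAt_comp {f : ℝ → ℝ} {G : M → ℝ} {x : M} (hf : DifferentiableAt ℝ f (G x))
    (hG : MDifferentiableAt 𝓘(ℝ, E) 𝓘(ℝ, ℝ) G x) (u : TangentSpace 𝓘(ℝ, E) x) :
    differentialAt (fun y => f (G y)) x u = deriv f (G x) * differentialAt G x u := by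
  have h := mfderiv_comp x hf.mdifferentiableAt hG
  rw [mfderiv_eq_fderiv] at h
  have h2 := congrArg (fun L : TangentSpace 𝓘(ℝ, E) x →L[ℝ] ℝ => L u) h
  have h3 : differentialAt (fun y => f (G y)) x u =
      fderiv ℝ f (G x) (differentialAt G x u : ℝ) := h2
  rw [h3, fderiv_eq_smul_deriv, smul_eq_mul, mul_comm]

theorem differentialAt_mul {a b : M → ℝ} {x : M}
    (ha : MDifferentiableAt 𝓘(ℝ, E) 𝓘(ℝ, ℝ) a x) (hb : MDifferentiableAt 𝓘(ℝ, E) 𝓘(ℝ, ℝ) b x)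
    (u : TangentSpace 𝓘(ℝ, E) x) :
    differentialAt (fun y => a y * b y) x u =
      a x * differentialAt b x u + b x * differentialAt a x u := by
  have h := (ha.hasMFDerivAt.mul hb.hasMFDerivAt).mfderiv
  exact congrArg (fun L : TangentSpace 𝓘(ℝ, E) x →L[ℝ] ℝ => L u) h

variable [FiniteDimensional ℝ E]

theorem poissonBracket_self (σ : SymplecticForm E M) (G : M → ℝ) (x : M) :
    σ.poissonBracket G G x = 0 := by
  linarith [σ.poissonBracket_swap G G x]

theorem poissonBracket_comp (σ : SymplecticForm E M) {f : ℝ → ℝ} {F G : M → ℝ} {x : M}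
    (hf : DifferentiableAt ℝ f (G x)) (hG : MDifferentiableAt 𝓘(ℝ, E) 𝓘(ℝ, ℝ) G x) :
    σ.poissonBracket F (fun y => f (G y)) x = deriv f (G x) * σ.poissonBracket F G x := by
  rw [poissonBracket_swap, poissonBracket_eq, differentialAt_comp hf hG, ← poissonBracket_eq,
    σ.poissonBracket_swap F G]
  ring

theorem poissonBracket_comp_mul (σ : SymplecticForm E M) {f : ℝ → ℝ} {G H : M → ℝ} {x : M}
    (hf : DifferentiableAt ℝ f (G x)) (hG : MDifferentiableAt 𝓘(ℝ, E) 𝓘(ℝ, ℝ) G x)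
    (hH : MDifferentiableAt 𝓘(ℝ, E) 𝓘(ℝ, ℝ) H x) :
    σ.poissonBracket (fun y => f (G y) * H y) G x = f (G x) * σ.poissonBracket H G x := by
  have h : MDifferentiableAt 𝓘(ℝ, E) 𝓘(ℝ, ℝ) (fun y => f (G y)) x :=
    hf.mdifferentiableAt.comp x hG
  rw [poissonBracket_eq, differentialAt_mul h hH, differentialAt_comp hf hG, ← poissonBracket_eq,
    ← poissonBracket_eq, poissonBracket_self]
  ring

/-- If the Hamiltonian flow of `G` has no trajectory of time-length at most `p` between
`X₁ \ X₃` and `X₃ \ X₁`, then `pb₃(X₁, X₂, X₃)` is bounded by any `c₁ c₂` with `c₁ > 1 / 2` and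
`c₂ > 1 / p`. -/
theorem pb₃_le_of_not_hasTrajectory [T2Space M] [SecondCountableTopology M]
    [IsManifold 𝓘(ℝ, E) ∞ M] (σ : SymplecticForm E M) {X₁ X₂ X₃ : Set M}
    (hX₁ : IsCompact X₁) (hX₃ : IsCompact X₃)
    {G : M → ℝ} (hG : G ∈ testFunctions E M)
    (hG₂ : ∀ x ∈ X₂, G x ≤ 0) (hG₁₃ : ∀ x ∈ X₁ ∩ X₃, 1 ≤ G x) {p : ℝ} (hp : 0 < p)
    (h₁₃ : ¬ σ.HasTrajectory G (X₁ \ X₃) (X₃ \ X₁) p)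
    (h₃₁ : ¬ σ.HasTrajectory G (X₃ \ X₁) (X₁ \ X₃) p)
    {c₁ c₂ : ℝ} (hc₁ : 1 / 2 < c₁) (hc₂ : 1 / p < c₂) :
    σ.pb₃ X₁ X₂ X₃ ≤ ENNReal.ofReal (c₁ * c₂) := by
  have : LocallyCompactSpace M := ChartedSpace.locallyCompactSpace E M
  obtain ⟨w, hw, hw0, ⟨δ, hδ, hw1⟩, hwn, hwd⟩ := exists_profile hc₁
  have hGc : IsClosed {x | G x ≤ 1 - δ} := isClosed_le hG.1.continuous continuous_const
  -- Cutting at `1 - δ` keeps the sets compact and away from `X₁ ∩ X₃`; beyond the cut `w(G)`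
  -- vanishes, so nothing is required of `H` there.
  have hsub₁ : ∀ x ∈ X₁ ∩ {x | G x ≤ 1 - δ}, x ∈ X₁ \ X₃ := fun x hx =>
    ⟨hx.1, fun h => by linarith [hG₁₃ x ⟨hx.1, h⟩, show G x ≤ 1 - δ from hx.2]⟩
  have hsub₃ : ∀ x ∈ X₃ ∩ {x | G x ≤ 1 - δ}, x ∈ X₃ \ X₁ := fun x hx =>
    ⟨hx.1, fun h => by linarith [hG₁₃ x ⟨h, hx.1⟩, show G x ≤ 1 - δ from hx.2]⟩
  obtain ⟨H, hH, hHA, hHB, hHC⟩ := exists_separating_function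
    (fun x₀ => σ.contDiffOn_chartField hG.1 x₀) hG.2
    (fun x hx => σ.hamiltonianVectorField_eq_zero hx) (hX₁.inter_right hGc) (hX₃.inter_right hGc)
    hp (fun γ hγ t ht h0 h1 => by
      rcases le_total 0 t with h | h
      · rw [abs_of_nonneg h] at ht
        exact h₁₃ ⟨γ, hγ, t, h, ht, hsub₁ _ h0, hsub₃ _ h1⟩
      · rw [abs_of_nonpos h] at ht
        refine h₃₁ ⟨γ ∘ (· + t), hγ.comp_add t, -t, by linarith, ht, ?_, ?_⟩
        · simpa using hsub₃ _ h1
        · simpa using hsub₁ _ h0) hc₂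
  have hwm : ContMDiff 𝓘(ℝ, E) 𝓘(ℝ, ℝ) ∞ fun x => w (G x) := hw.contMDiff.comp hG.1
  have hF : (fun x => w (G x) * H x) ∈ testFunctions E M := ⟨hwm.mul hH.1, hH.2.mul_left⟩
  have hP : (fun x => 1 - w (G x)) ∈ testFunctions E M :=
    ⟨contMDiff_const.sub hwm, hG.2.comp_left (g := fun t => 1 - w t) (by simp [hw0 0 le_rfl])⟩
  have hb : σ.pb₃ X₁ X₂ X₃ ≤ ⨆ x, ENNReal.ofReal
      |σ.poissonBracket (fun x => w (G x) * H x) (fun x => 1 - w (G x)) x| := by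
    refine sInf_le ⟨_, hF, _, hP, fun x hx => ?_, fun x hx => ?_, fun x hx => ?_, rfl⟩
    · rcases le_total (G x) (1 - δ) with h | h
      · exact mul_nonpos_of_nonneg_of_nonpos (hwn _) (hHA x ⟨hx, h⟩)
      · rw [hw1 _ h, zero_mul]
    · rw [hw0 _ (hG₂ x hx), sub_self]
    · rcases le_total (G x) (1 - δ) with h | h
      · nlinarith [hwn (G x), hHB x ⟨hx, h⟩]
      · rw [hw1 _ h]; simp
  refine hb.trans (iSup_le fun x => ENNReal.ofReal_le_ofReal ?_)
  have hGd : MDifferentiableAt 𝓘(ℝ, E) 𝓘(ℝ, ℝ) G x := (hG.1 x).mdifferentiableAt (by simp)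
  have hHd : MDifferentiableAt 𝓘(ℝ, E) 𝓘(ℝ, ℝ) H x := (hH.1 x).mdifferentiableAt (by simp)
  have hwx : DifferentiableAt ℝ w (G x) := hw.differentiable (by simp) _
  have hc₂0 : 0 < c₂ := (one_div_pos.2 hp).trans hc₂
  rw [σ.poissonBracket_comp (f := fun t => 1 - w t) (hwx.const_sub 1) hGd, deriv_const_sub,
    σ.poissonBracket_comp_mul hwx hGd hHd, ← mul_assoc, neg_mul, abs_mul, abs_neg]
  refine mul_le_mul (hwd _) ?_ (abs_nonneg _) (by linarith)
  rw [poissonBracket_eq]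
  by_cases hx : x ∈ tsupport G
  · exact hHC x hx
  · rw [σ.hamiltonianVectorField_eq_zero hx, map_zero, abs_zero]
    exact hc₂0.le

end SymplecticForm


/-! ### Conclusion -/

theorem mainTheorem7 {E : Type*} [NormedAddCommGroup E] [NormedSpace ℝ E] [FiniteDimensional ℝ E]
    {M : Type*} [TopologicalSpace M] [T2Space M] [SecondCountableTopology M]
    [ChartedSpace E M] [IsManifold 𝓘(ℝ, E) ∞ M]
    (σ : SymplecticForm E M) (X₁ X₂ X₃ : Set M)
    (hX₁ : IsCompact X₁) (hX₂ : IsCompact X₂) (hX₃ : IsCompact X₃)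
    (hX : X₁ ∩ X₂ ∩ X₃ = ∅)
    (G : M → ℝ) (hG : G ∈ SymplecticForm.testFunctions E M)
    (hG₂ : ∀ x ∈ X₂, G x ≤ 0) (hG₁₃ : ∀ x ∈ X₁ ∩ X₃, 1 ≤ G x)
    (p₀ : ℝ≥0∞) (hp₀ : p₀ = 1 / (2 * σ.pb₃ X₁ X₂ X₃)) (hpos : 0 < p₀)
    (p : ℝ) (hp : p₀ < ENNReal.ofReal p) :
    σ.HasTrajectory G (X₁ \ X₃) (X₃ \ X₁) p ∨ σ.HasTrajectory G (X₃ \ X₁) (X₁ \ X₃) p := by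
  have hp0 : 0 < p := ENNReal.ofReal_pos.1 (hpos.trans hp)
  by_contra hno
  rw [not_or] at hno
  set b := σ.pb₃ X₁ X₂ X₃
  have hlt : ENNReal.ofReal (1 / (2 * p)) < b := by
    rw [one_div, ENNReal.ofReal_inv_of_pos (by positivity), ENNReal.inv_lt_iff_inv_lt]
    rw [hp₀, one_div, ENNReal.mul_inv (Or.inl (by simp)) (Or.inl (by simp))] at hp
    rw [ENNReal.ofReal_mul (by simp), ENNReal.ofReal_ofNat]
    calc b⁻¹ = 2 * (2⁻¹ * b⁻¹) := by
          rw [← mul_assoc, ENNReal.mul_inv_cancel (by simp) (by simp), one_mul]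
      _ < 2 * ENNReal.ofReal p := (ENNReal.mul_lt_mul_iff_right (by simp) (by simp)).2 hp
  -- The excess `2 * p * q > 1` is split evenly: multiplying both `1 / 2` and `1 / p` by its square
  -- root gives strict upper bounds whose product is exactly `q`, below `pb₃`.
  obtain ⟨q, hq0, hq, hqb⟩ := ENNReal.lt_iff_exists_real_btwn.1 hlt
  have hq' : 1 / (2 * p) < q := (ENNReal.ofReal_lt_ofReal_iff_of_nonneg (by positivity)).1 hq
  have hs : 1 < 2 * p * q := by
    rwa [div_lt_iff₀ (by positivity), mul_comm] at hq'
  have hs1 : 1 < Real.sqrt (2 * p * q) := Real.lt_sqrt_of_sq_lt (by simpa using hs)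
  have hle := σ.pb₃_le_of_not_hasTrajectory hX₁ hX₃ hG hG₂ hG₁₃ hp0 hno.1 hno.2
    (c₁ := 1 / 2 * Real.sqrt (2 * p * q)) (c₂ := 1 / p * Real.sqrt (2 * p * q))
    (lt_mul_of_one_lt_right (by positivity) hs1) (lt_mul_of_one_lt_right (by positivity) hs1)
  have heq : 1 / 2 * Real.sqrt (2 * p * q) * (1 / p * Real.sqrt (2 * p * q)) = q := by
    have h1 : Real.sqrt (2 * p * q) * Real.sqrt (2 * p * q) = 2 * p * q :=
      Real.mul_self_sqrt (by positivity)
    calc _ = 1 / 2 * (1 / p) * (Real.sqrt (2 * p * q) * Real.sqrt (2 * p * q)) := by ring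
      _ = q := by rw [h1]; field_simp
  rw [heq] at hle
  exact absurd hle (not_le.2 hqb)
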